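/- Let $d\in\mathbb N$ (with $d=0$ allowed) and let $\psi:\mathbb R^d\to\mathbb R$ be a bounded continuous function, not identically zero, that is positive definite: $k(x,y)=\psi(x-y)$ is symmetric and $\sum_{l,j=1}^n\alpha_l\alpha_j\,\psi(x_l-x_j)\ge 0$ for all $n$, all $\alpha_1,\dots,\alpha_n\in\mathbb R$ and all $x_1,\dots,x_n\in\mathbb R^d$. Let $\mathcal H$ be the reproducing kernel Hilbert space of real functions on $\mathbb R^d$ with kernel $k$. The kernel $k$ is called $c_0$-universal if it is bounded, $k(\cdot,x)\in C_0(\mathbb R^d)$ for every $x$ (where $C_0(\mathbb R^d)$ is the space of real continuous functions vanishing at infinity), and for every $g\in C_0(\mathbb R^d)$ and $\varepsilon>0$ there is $f\in\mathcal H$ with $\sup_{x\in\mathbb R^d}|f(x)-g(x)|\le\varepsilon$. It is called $cc$-universal if it is continuous and for every compact $Z\subset\mathbb R^d$, every continuous $g:Z\to\mathbb R$ and every $\varepsilon>0$ there is $f\in\mathcal H$ with $|f(z)-g(z)|\le\varepsilon$ for all $z\in Z$. The support $\operatorname{supp}(\Lambda)$ of a Borel measure $\Lambda\ge0$ is the set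 of points all of whose open neighbourhoods have positive $\Lambda$-measure. Then there is exactly one finite nonnegative Borel measure $\Lambda$ on $\mathbb R^d$ (the Bochner measure of $\psi$) with $$\psi(x)=\int_{\mathbb R^d}e^{-ix^T\omega}\,d\Lambda(\omega)\qquad\text{for all }x\in\mathbb R^d,$$ and the following hold. (a) If $\psi\in C_0(\mathbb R^d)$, then $k$ is $c_0$-universal if and only if $\operatorname{supp}(\Lambda)=\mathbb R^d$. (b) If $\psi$ has compact support, then $k$ is $c_0$-universal. (c) If $\operatorname{supp}(\Lambda)$ has nonempty interior, then $k$ is $cc$-universal. -/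

import Mathlib

open MeasureTheory Filter Topology
open scoped BoundedContinuousFunction ZeroAtInfty

/-- A (real) positive definite kernel: a symmetric function `k : X × X → ℝ` with
`∑ₗ ∑ⱼ αₗ αⱼ k(xₗ, xⱼ) ≥ 0` for all finite families of reals `α` and points `x`. -/
def IsPDKernel {X : Type*} (k : X → X → ℝ) : Prop :=
  (∀ x y, k x y = k y x) ∧
    ∀ (n : ℕ) (α : Fin n → ℝ) (x : Fin n → X),
      0 ≤ ∑ l, ∑ j, α l * α j * k (x l) (x j)

/-- The kernel `k`, each value `k x y` being read as the operator "multiplication by `k x y`"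
on `ℝ`; this is the form in which Mathlib's theory of reproducing kernel Hilbert spaces takes
kernels. -/
noncomputable def kernelMatrix {X : Type*} (k : X → X → ℝ) : Matrix X X (ℝ →L[ℝ] ℝ) :=
  Matrix.of fun x y => k x y • (1 : ℝ →L[ℝ] ℝ)

theorem kernelMatrix_apply {X : Type*} (k : X → X → ℝ) (x y : X) (t : ℝ) :
    kernelMatrix k x y t = k x y * t := by
  simp [kernelMatrix]

theorem IsPDKernel.posSemidef {X : Type*} {k : X → X → ℝ} (hk : IsPDKernel k) :
    (kernelMatrix k).PosSemidef := by
  have key := (RKHS.posSemidef_tfae (K := kernelMatrix k)).out 0 2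
  refine key.mpr ⟨?_, fun v => ?_⟩
  · ext x y
    simp [kernelMatrix, hk.1 x y]
  · have h := hk.2 v.support.card (fun i => v (v.support.equivFin.symm i))
      (fun i => (v.support.equivFin.symm i : X))
    have e : ∀ F : X → ℝ, ∑ i, F (v.support.equivFin.symm i : X) = ∑ x ∈ v.support, F x := by
      intro F
      rw [Equiv.sum_comp v.support.equivFin.symm (fun y : v.support => F y)]
      exact Finset.sum_coe_sort v.support F
    rw [e (fun x => ∑ j, v x * v (v.support.equivFin.symm j) *
      k x (v.support.equivFin.symm j : X)),
      Finset.sum_congr rfl fun x _ => e (fun y => v x * v y * k x y)] at h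
    refine h.trans_eq ?_
    change _ = ∑ x ∈ v.support, ∑ y ∈ v.support, inner ℝ (kernelMatrix k y x (v x)) (v y)
    refine Finset.sum_congr rfl fun x _ => Finset.sum_congr rfl fun y _ => ?_
    rw [kernelMatrix_apply, hk.1 x y]
    simp
    ring

/-- The reproducing kernel Hilbert space with reproducing kernel `k`, as a set of real-valued
functions on `X`. -/
def rkhs {X : Type*} (k : X → X → ℝ) (hk : IsPDKernel k) : Set (X → ℝ) :=
  haveI : Fact (kernelMatrix k).PosSemidef := ⟨hk.posSemidef⟩
  Set.range fun (f : RKHS.OfKernel (kernelMatrix k)) (x : X) => f x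

/-- `c₀`-universality of a kernel `k` on a locally compact Hausdorff space `X`:
`k` is a bounded kernel, `k(·, x) ∈ C₀(X)` for all `x`, and every `g ∈ C₀(X)` can be
approximated uniformly on `X`, to any accuracy, by members of the RKHS of `k`. -/
def IsC0Universal {X : Type*} [TopologicalSpace X] (k : X → X → ℝ) : Prop :=
  ∃ hk : IsPDKernel k,
    (∃ C : ℝ, ∀ x y, |k x y| ≤ C) ∧
    (∀ x, Continuous (fun y => k y x) ∧ Tendsto (fun y => k y x) (cocompact X) (𝓝 0)) ∧
    ∀ (g : C₀(X, ℝ)) (ε : ℝ), 0 < ε → ∃ f ∈ rkhs k hk, ∀ x, |f x - g x| ≤ ε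

/-- `cc`-universality of a kernel `k` on a Hausdorff space `X`: `k` is a continuous kernel, and
for every compact `Z ⊆ X`, every continuous `g : Z → ℝ` can be approximated uniformly on `Z`,
to any accuracy, by restrictions to `Z` of members of the RKHS of `k`. -/
def IsCCUniversal {X : Type*} [TopologicalSpace X] (k : X → X → ℝ) : Prop :=
  ∃ hk : IsPDKernel k,
    Continuous (fun p : X × X => k p.1 p.2) ∧
    ∀ Z : Set X, IsCompact Z → ∀ (g : C(Z, ℝ)) (ε : ℝ), 0 < ε →
      ∃ f ∈ rkhs k hk, ∀ z : Z, |f z - g z| ≤ ε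

/-- `Λ` is a finite nonnegative Borel measure on `ℝᵈ` whose Fourier transform is `ψ`, i.e.
`ψ(x) = ∫ exp(-i xᵀω) dΛ(ω)` for all `x`. -/
def IsBochnerMeasure {d : ℕ} (ψ : EuclideanSpace ℝ (Fin d) → ℝ)
    (Λ : Measure (EuclideanSpace ℝ (Fin d))) : Prop :=
  IsFiniteMeasure Λ ∧
    ∀ x, (ψ x : ℂ) = ∫ ω, Complex.exp (-(Complex.I * ((inner ℝ x ω : ℝ) : ℂ))) ∂Λ

/-! ### Continuous functions on the support of a measure -/

section Support

variable {E : Type*} [TopologicalSpace E] [MeasurableSpace E]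

/-! Bochner's theorem. Averaging the positive definiteness inequality over i.i.d. points turns it
into `∬ K(x - y) dμ dμ ≥ 0`. For Gaussian `μ` and `K = ψ · cos⟨·, w⟩` this says that ψ damped by a
Gaussian has a nonnegative Fourier transform. That transform is then integrable, so Fourier
inversion exhibits the damped ψ as the characteristic function of a finite measure. As the damping
is removed, these measures stay tight and a limit point is `Λ`. Uniqueness is injectivity of the
characteristic function.

Universality. By Hahn–Banach it suffices that a continuous functional `L` vanishing on every section
`ψ(· - y)` is zero. Put `G(w) = L(e_w)`, where `e_w(x) = exp(i⟨x, w⟩)`. Since ψ is a superposition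
of characters, `L(ψ(· - y)) = ∫ G(w) exp(-i⟨w, y⟩) dΛ(w)`. Hence the complex measure `G dΛ` has zero
Fourier transform, so `G = 0` almost everywhere, and by continuity on `supp Λ`. On `C(Z)`, `G` is
analytic along lines, so vanishing on an open set suffices, and Stone–Weierstrass gives `L = 0`. On
`C₀` the characters are not in the space, so `G` is a limit over cutoffs; full support makes it zero
everywhere, and Fourier inversion on Schwartz functions gives `L = 0`. No Riesz representation is
needed.

Conversely, if `supp Λ` misses a ball, the Fourier transform of a bump living there (after rescaling
by 2π) is a nonzero integrable function annihilating all sections, hence by universality all of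
`C₀`, which is absurd. For compactly supported ψ, `Λ` has as density the rescaled Fourier transform
of ψ, which cannot vanish on a nonempty open set, so (b) follows from (a). -/

theorem eq_zero_of_mem_support_of_ae_eq_zero {F : Type*} [TopologicalSpace F] [T1Space F] [Zero F]
    {μ : Measure E} {f : E → F} (hf : Continuous f) (h : ∀ᵐ x ∂μ, f x = 0) {x : E}
    (hx : x ∈ μ.support) : f x = 0 := by
  by_contra hne
  have hU : {y | f y ≠ 0} ∈ 𝓝 x := (isOpen_ne.preimage hf).mem_nhds hne
  have := (Measure.mem_support_iff_forall x).1 hx _ hU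
  exact this.ne' (by simpa [ae_iff] using h)

end Support

/-! ### Injectivity of the Fourier transform on complex measures with a density -/

section FourierUniqueness

variable {E : Type*} [NormedAddCommGroup E] [InnerProductSpace ℝ E] [MeasurableSpace E]

theorem charFun_withDensity_ofReal {μ : Measure E} {f : E → ℝ} (hf : Measurable f) (t : E) :
    charFun (μ.withDensity fun x => ENNReal.ofReal (f x)) t =
      ∫ x, ((max (f x) 0 : ℝ) : ℂ) * Complex.exp ((inner ℝ x t : ℝ) * Complex.I) ∂μ := by
  rw [charFun_apply]
  have h := integral_withDensity_eq_integral_smul (μ := μ) (f := fun x => (f x).toNNReal)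
    (by fun_prop) (fun x => Complex.exp ((inner ℝ x t : ℝ) * Complex.I))
  simpa [NNReal.smul_def, ENNReal.ofReal] using h

variable [SecondCountableTopology E] [BorelSpace E]

theorem integrable_mul_character {μ : Measure E} {f : E → ℂ} (hf : Integrable f μ) (t : E) :
    Integrable (fun x => f x * Complex.exp ((inner ℝ x t : ℝ) * Complex.I)) μ :=
  hf.mul_bdd (c := 1) (by fun_prop) (ae_of_all _ fun x => by
    simp [Complex.norm_exp_ofReal_mul_I])

variable [CompleteSpace E]

/-- The positive and negative parts of `f dμ` are finite measures with equal characteristic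
functions, hence equal, and their densities agree almost everywhere. -/
theorem ae_eq_zero_of_integral_real_mul_character_eq_zero {μ : Measure E} {f : E → ℝ}
    (hf : Measurable f) (hi : Integrable f μ)
    (h : ∀ t, ∫ x, (f x : ℂ) * Complex.exp ((inner ℝ x t : ℝ) * Complex.I) ∂μ = 0) :
    ∀ᵐ x ∂μ, f x = 0 := by
  have fin₁ : IsFiniteMeasure (μ.withDensity fun x => ENNReal.ofReal (f x)) :=
    isFiniteMeasure_withDensity_ofReal hi.2
  have fin₂ : IsFiniteMeasure (μ.withDensity fun x => ENNReal.ofReal (-f x)) :=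
    isFiniteMeasure_withDensity_ofReal hi.neg.2
  have i₁ : Integrable (fun x => ((max (f x) 0 : ℝ) : ℂ)) μ := hi.pos_part.ofReal
  have i₂ : Integrable (fun x => ((max (-f x) 0 : ℝ) : ℂ)) μ := hi.neg.pos_part.ofReal
  have key : (μ.withDensity fun x => ENNReal.ofReal (f x)) =
      μ.withDensity fun x => ENNReal.ofReal (-f x) := by
    refine Measure.ext_of_charFun (funext fun t => ?_)
    rw [charFun_withDensity_ofReal hf, charFun_withDensity_ofReal (f := fun x => -f x) hf.neg,
      ← sub_eq_zero,
      ← integral_sub (integrable_mul_character i₁ t) (integrable_mul_character i₂ t), ← h t]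
    refine integral_congr_ae (ae_of_all _ fun x => ?_)
    simp only
    rw [← sub_mul, ← Complex.ofReal_sub]
    congr 2
    rcases le_total 0 (f x) with h0 | h0 <;> simp [h0]
  have h2 := (withDensity_eq_iff (by fun_prop) (by fun_prop) (by
    exact hi.lintegral_lt_top.ne)).1 key
  filter_upwards [h2] with x hx
  rcases le_total 0 (f x) with h0 | h0
  · rw [ENNReal.ofReal_of_nonpos (p := -f x) (by linarith), ENNReal.ofReal_eq_zero] at hx
    linarith
  · rw [ENNReal.ofReal_of_nonpos h0, eq_comm, ENNReal.ofReal_eq_zero] at hx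
    linarith

/-- A function whose Fourier transform with respect to `μ` vanishes is zero almost everywhere. -/
theorem ae_eq_zero_of_integral_mul_character_eq_zero {μ : Measure E} {f : E → ℂ}
    (hf : Measurable f) (hi : Integrable f μ)
    (h : ∀ t, ∫ x, f x * Complex.exp ((inner ℝ x t : ℝ) * Complex.I) ∂μ = 0) :
    ∀ᵐ x ∂μ, f x = 0 := by
  have hconj : ∀ t, ∫ x, (starRingEnd ℂ) (f x) *
      Complex.exp ((inner ℝ x t : ℝ) * Complex.I) ∂μ = 0 := by
    intro t
    have := congrArg (starRingEnd ℂ) (h (-t))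
    rw [← integral_conj] at this
    simpa [← Complex.exp_conj] using this
  have hic : Integrable (fun x => (starRingEnd ℂ) (f x)) μ := by
    simpa using (Complex.conjCLE.toContinuousLinearMap.integrable_comp hi)
  have hre : ∀ᵐ x ∂μ, (f x).re = 0 := by
    refine ae_eq_zero_of_integral_real_mul_character_eq_zero (by fun_prop) hi.re fun t => ?_
    have e : ∀ x, ((f x).re : ℂ) * Complex.exp ((inner ℝ x t : ℝ) * Complex.I) =
        2⁻¹ * (f x * Complex.exp ((inner ℝ x t : ℝ) * Complex.I) +
          (starRingEnd ℂ) (f x) * Complex.exp ((inner ℝ x t : ℝ) * Complex.I)) := fun x => by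
      rw [Complex.re_eq_add_conj]; ring
    simp_rw [e]
    rw [integral_const_mul, integral_add (integrable_mul_character hi t)
      (integrable_mul_character hic t), h, hconj]
    simp
  have him : ∀ᵐ x ∂μ, (f x).im = 0 := by
    refine ae_eq_zero_of_integral_real_mul_character_eq_zero (by fun_prop) hi.im fun t => ?_
    have e : ∀ x, ((f x).im : ℂ) * Complex.exp ((inner ℝ x t : ℝ) * Complex.I) =
        (2 * Complex.I)⁻¹ * (f x * Complex.exp ((inner ℝ x t : ℝ) * Complex.I) -
          (starRingEnd ℂ) (f x) * Complex.exp ((inner ℝ x t : ℝ) * Complex.I)) := fun x => by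
      rw [Complex.im_eq_sub_conj]; ring
    simp_rw [e]
    rw [integral_const_mul, integral_sub (integrable_mul_character hi t)
      (integrable_mul_character hic t), h, hconj]
    simp
  filter_upwards [hre, him] with x h1 h2
  exact Complex.ext h1 h2

end FourierUniqueness

/-! ### Kernel sections in the RKHS and the Hahn–Banach density criterion -/

section Kernel

variable {X : Type*} {k : X → X → ℝ}

/-- The reproducing kernel Hilbert space of `k` as a submodule of the space of functions. -/
noncomputable def rkhsSubmodule (k : X → X → ℝ) (hk : IsPDKernel k) : Submodule ℝ (X → ℝ) :=
  haveI : Fact (kernelMatrix k).PosSemidef := ⟨hk.posSemidef⟩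
  (RKHS.coeCLM ℝ (H := RKHS.OfKernel (kernelMatrix k))).range

theorem ofKernel_kerFun_apply [Fact (kernelMatrix k).PosSemidef] (y : X) (v : ℝ) (x : X) :
    RKHS.kerFun (RKHS.OfKernel (kernelMatrix k)) y v x = k x y * v := by
  rw [RKHS.kerFun_apply, RKHS.OfKernel.kernel_ofKernel, kernelMatrix_apply]

theorem section_mem_rkhsSubmodule (hk : IsPDKernel k) (y : X) :
    (fun x => k x y) ∈ rkhsSubmodule k hk := by
  have : Fact (kernelMatrix k).PosSemidef := ⟨hk.posSemidef⟩
  refine ⟨RKHS.kerFun (RKHS.OfKernel (kernelMatrix k)) y 1, funext fun x => ?_⟩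
  exact (ofKernel_kerFun_apply y 1 x).trans (mul_one _)

/-- Sections span a dense subspace in the RKHS norm, and `|h x| ≤ ‖h‖ √(k x x)`; for a bounded
kernel, norm convergence is therefore uniform convergence. -/
theorem exists_span_sections_approx (hk : IsPDKernel k) {C : ℝ} (hC : ∀ x y, |k x y| ≤ C)
    {f : X → ℝ} (hf : f ∈ rkhs k hk) {ε : ℝ} (hε : 0 < ε) :
    ∃ g ∈ Submodule.span ℝ (Set.range fun y x => k x y), ∀ x, |f x - g x| ≤ ε := by
  have : Fact (kernelMatrix k).PosSemidef := ⟨hk.posSemidef⟩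
  obtain ⟨f, rfl⟩ := hf
  let H := RKHS.OfKernel (kernelMatrix k)
  have hmem : f ∈ closure (Submodule.span ℝ {RKHS.kerFun H x v | (x) (v)} : Set H) := by
    rw [← Submodule.topologicalClosure_coe, RKHS.kerFun_dense]
    trivial
  have hC0 : ∀ x, ‖RKHS.kernel H x x‖ ≤ C := fun x => by
    rw [RKHS.OfKernel.kernel_ofKernel]
    refine ContinuousLinearMap.opNorm_le_bound _ ((abs_nonneg _).trans (hC x x)) fun t => ?_
    rw [kernelMatrix_apply, norm_mul]
    exact mul_le_mul_of_nonneg_right (hC x x) (norm_nonneg t)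
  have hδ : 0 < ε / (√C + 1) := by positivity
  obtain ⟨g, hg, hfg⟩ := Metric.mem_closure_iff.1 hmem _ hδ
  refine ⟨g, ?_, fun x => ?_⟩
  · have hmap : (RKHS.coeCLM ℝ (H := H)).toLinearMap g ∈
        (Submodule.span ℝ {RKHS.kerFun H x v | (x) (v)}).map (RKHS.coeCLM ℝ (H := H)).toLinearMap :=
      Submodule.mem_map_of_mem hg
    rw [Submodule.map_span] at hmap
    refine Submodule.span_le.2 ?_ hmap
    rintro _ ⟨_, ⟨y, v, rfl⟩, rfl⟩
    have e : (RKHS.coeCLM ℝ (H := H)).toLinearMap (RKHS.kerFun H y v) = v • fun x => k x y := by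
      funext x
      exact (ofKernel_kerFun_apply y v x).trans (mul_comm _ _)
    rw [e]
    exact Submodule.smul_mem _ _ (Submodule.subset_span ⟨y, rfl⟩)
  · have h1 := RKHS.norm_apply_le (f - g) x
    rw [RKHS.coe_sub, Pi.sub_apply, Real.norm_eq_abs] at h1
    rw [dist_eq_norm] at hfg
    change |(f : H) x - (g : H) x| ≤ ε
    calc |(f : H) x - (g : H) x| ≤ ‖f - g‖ * √‖RKHS.kernel H x x‖ := h1
      _ ≤ ε / (√C + 1) * (√C + 1) := by
        refine mul_le_mul hfg.le ?_ (by positivity) hδ.le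
        have := Real.sqrt_le_sqrt (hC0 x)
        linarith
      _ = ε := by field_simp

/-- Real and imaginary parts of complex combinations of kernel sections belong to the RKHS. -/
theorem exists_rkhs_re_im {P B : Type*} [AddCommGroup B] [Module ℂ B] (hk : IsPDKernel k)
    (T : B →ₗ[ℂ] (P → ℂ)) (ι : P → X) (v : X → B) (hv : ∀ y p, T (v y) p = k (ι p) y)
    {s : B} (hs : s ∈ Submodule.span ℂ (Set.range v)) :
    (∃ f ∈ rkhsSubmodule k hk, ∀ p, f (ι p) = (T s p).re) ∧
      ∃ f ∈ rkhsSubmodule k hk, ∀ p, f (ι p) = (T s p).im := by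
  induction hs using Submodule.span_induction with
  | mem _ h =>
    obtain ⟨y, rfl⟩ := h
    exact ⟨⟨_, section_mem_rkhsSubmodule hk y, fun p => by simp [hv]⟩,
      ⟨0, Submodule.zero_mem _, fun p => by simp [hv]⟩⟩
  | zero => exact ⟨⟨0, Submodule.zero_mem _, by simp⟩, ⟨0, Submodule.zero_mem _, by simp⟩⟩
  | add s t _ _ hs ht =>
    obtain ⟨⟨f, hf, ef⟩, ⟨g, hg, eg⟩⟩ := hs
    obtain ⟨⟨f', hf', ef'⟩, ⟨g', hg', eg'⟩⟩ := ht
    exact ⟨⟨_, Submodule.add_mem _ hf hf', fun p => by simp [ef, ef']⟩,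
      ⟨_, Submodule.add_mem _ hg hg', fun p => by simp [eg, eg']⟩⟩
  | smul c s _ hs =>
    obtain ⟨⟨f, hf, ef⟩, ⟨g, hg, eg⟩⟩ := hs
    exact ⟨⟨_, Submodule.sub_mem _ (Submodule.smul_mem _ c.re hf) (Submodule.smul_mem _ c.im hg),
        fun p => by simp [ef, eg]⟩,
      ⟨_, Submodule.add_mem _ (Submodule.smul_mem _ c.re hg) (Submodule.smul_mem _ c.im hf),
        fun p => by simp [ef, eg]⟩⟩

/-- A subspace of a complex normed space is dense if every continuous linear functional vanishing
on it is zero. -/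
theorem mem_closure_span_of_forall_dual {B : Type*} [NormedAddCommGroup B] [NormedSpace ℂ B]
    {S : Set B} (h : ∀ L : B →L[ℂ] ℂ, (∀ s ∈ S, L s = 0) → L = 0) (b : B) :
    b ∈ closure (Submodule.span ℂ S : Set B) := by
  by_contra hb
  obtain ⟨L, u, hL, hu⟩ := RCLike.geometric_hahn_banach_closed_point (𝕜 := ℂ)
    (s := closure (Submodule.span ℂ S : Set B))
    (by
      have := ((Submodule.span ℂ S).topologicalClosure.restrictScalars ℝ).convex
      simpa using this) isClosed_closure hb
  have hzero : ∀ s ∈ Submodule.span ℂ S, L s = 0 := by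
    intro s hs
    by_contra hne
    -- Rescaling `s` so that `L` takes the value `|u| + 1` exceeds the bound `u`, so a functional
    -- bounded above on a subspace must vanish there.
    have hlt := hL _ (subset_closure (Submodule.smul_mem _ (((|u| + 1 : ℝ) : ℂ) / L s) hs))
    rw [map_smul, smul_eq_mul, div_mul_cancel₀ _ hne] at hlt
    have h' : (RCLike.re ((|u| + 1 : ℝ) : ℂ) : ℝ) = |u| + 1 := Complex.ofReal_re _
    rw [h'] at hlt
    linarith [le_abs_self u]
  have h0 := hL 0 (subset_closure (Submodule.zero_mem _))
  rw [h L fun s hs => hzero s (Submodule.subset_span hs)] at hu h0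
  simp at hu h0
  linarith

end Kernel

/-! ### From finite sums to double integrals -/

section Sampling

variable {X : Type*} [MeasurableSpace X]

theorem map_pi_pair {n : ℕ} (μ : Measure X) [IsProbabilityMeasure μ] {l j : Fin n} (h : l ≠ j) :
    (Measure.pi fun _ : Fin n => μ).map (fun x => (x l, x j)) = μ.prod μ := by
  have hi : ProbabilityTheory.iIndepFun (fun i (x : Fin n → X) => x i)
      (Measure.pi fun _ : Fin n => μ) :=
    ProbabilityTheory.iIndepFun_pi (X := fun _ x => x) fun _ => aemeasurable_id
  have h2 := (ProbabilityTheory.indepFun_iff_map_prod_eq_prod_map_map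
    (measurable_pi_apply l).aemeasurable (measurable_pi_apply j).aemeasurable).1 (hi.indepFun h)
  rw [h2, (measurePreserving_eval (fun _ : Fin n => μ) l).map_eq,
    (measurePreserving_eval (fun _ : Fin n => μ) j).map_eq]

/-- Take expectations of the double sum over `n` independent points with law `μ`: the `n(n-1)`
off-diagonal terms each contribute the integral `A`, the diagonal at most `nC`. Were `A` negative,
the total would be negative for large `n`. -/
theorem integral_prod_nonneg_of_sum_nonneg_of_isProbabilityMeasure (μ : Measure X)
    [IsProbabilityMeasure μ] {K : X × X → ℝ} (hK : Measurable K) {C : ℝ} (hC : ∀ p, |K p| ≤ C)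
    (h : ∀ (n : ℕ) (x : Fin n → X), 0 ≤ ∑ l, ∑ j, K (x l, x j)) :
    0 ≤ ∫ p, K p ∂μ.prod μ := by
  set A := ∫ p, K p ∂μ.prod μ with hA
  have hint : ∀ {n : ℕ} (l j : Fin n), Integrable (fun x : Fin n → X => K (x l, x j))
      (Measure.pi fun _ => μ) := fun l j =>
    Integrable.of_bound (hK.comp ((measurable_pi_apply l).prodMk
      (measurable_pi_apply j))).aestronglyMeasurable C (ae_of_all _ fun x => hC _)
  have hoff : ∀ {n : ℕ} (l j : Fin n), l ≠ j →
      ∫ x : Fin n → X, K (x l, x j) ∂(Measure.pi fun _ => μ) = A := by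
    intro n l j hlj
    rw [hA, ← map_pi_pair μ hlj, integral_map ((measurable_pi_apply l).prodMk
      (measurable_pi_apply j)).aemeasurable hK.aestronglyMeasurable]
  have hdiag : ∀ {n : ℕ} (l : Fin n),
      ∫ x : Fin n → X, K (x l, x l) ∂(Measure.pi fun _ => μ) ≤ C := by
    intro n l
    have := integral_mono (hint l l) (integrable_const C) fun x => (abs_le.1 (hC _)).2
    simpa using this
  have hn : ∀ n : ℕ, 0 ≤ (n : ℝ) * (C + (n - 1) * A) := by
    intro n
    have h0 : 0 ≤ ∫ x : Fin n → X, ∑ l, ∑ j, K (x l, x j) ∂(Measure.pi fun _ => μ) :=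
      integral_nonneg fun x => h n x
    rw [integral_finsetSum _ fun l _ => integrable_finsetSum _ fun j _ => hint l j] at h0
    refine h0.trans ?_
    calc _ ≤ ∑ l : Fin n, (C + (n - 1) * A) := by
          refine Finset.sum_le_sum fun l _ => ?_
          rw [integral_finsetSum _ fun j _ => hint l j,
            ← Finset.add_sum_erase _ _ (Finset.mem_univ l)]
          refine add_le_add (hdiag l) (le_of_eq ?_)
          rw [Finset.sum_congr rfl fun j hj => hoff l j (Finset.ne_of_mem_erase hj).symm]
          have : 1 ≤ n := by have := l.2; omega
          simp [Finset.card_erase_of_mem, Nat.cast_sub this]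
      _ = _ := by simp [mul_add]
  by_contra hneg
  push Not at hneg
  obtain ⟨N, hN⟩ := exists_nat_gt (C / -A + 1)
  have h1 := hn (N + 1)
  have hN1 : (0 : ℝ) < (N + 1 : ℕ) := by positivity
  have h2 := nonneg_of_mul_nonneg_right h1 hN1
  have h3 : C / -A < N := by linarith
  rw [div_lt_iff₀ (by linarith)] at h3
  push_cast at h2
  linarith

theorem integral_prod_nonneg_of_sum_nonneg (μ : Measure X)
    [IsFiniteMeasure μ] {K : X × X → ℝ} (hK : Measurable K) {C : ℝ} (hC : ∀ p, |K p| ≤ C)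
    (h : ∀ (n : ℕ) (x : Fin n → X), 0 ≤ ∑ l, ∑ j, K (x l, x j)) :
    0 ≤ ∫ p, K p ∂μ.prod μ := by
  rcases eq_or_ne μ 0 with rfl | hμ
  · simp
  have : NeZero μ := ⟨hμ⟩
  have hp : IsProbabilityMeasure ((μ Set.univ)⁻¹ • μ) := inferInstance
  have h1 := integral_prod_nonneg_of_sum_nonneg_of_isProbabilityMeasure ((μ Set.univ)⁻¹ • μ)
    hK hC h
  have hne : μ Set.univ ≠ 0 := by simpa using hμ
  rw [Measure.prod_smul_left, Measure.prod_smul_right, smul_smul, integral_smul_measure] at h1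
  refine nonneg_of_mul_nonneg_right h1 ?_
  refine ENNReal.toReal_pos ?_ ?_
  · simp
  · exact ENNReal.mul_ne_top (ENNReal.inv_ne_top.2 hne) (ENNReal.inv_ne_top.2 hne)

end Sampling

/-! ### Positivity of Gaussian-damped cosine transforms -/

section Bochner

variable {E : Type*} [NormedAddCommGroup E]

theorem IsPDKernel.even {ψ : E → ℝ} (hψ : IsPDKernel fun x y : E => ψ (x - y)) (x : E) :
    ψ (-x) = ψ x := by
  simpa using hψ.1 0 x

theorem IsPDKernel.apply_zero_nonneg {ψ : E → ℝ} (hψ : IsPDKernel fun x y : E => ψ (x - y)) :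
    0 ≤ ψ 0 := by
  simpa using hψ.2 1 (fun _ => 1) (fun _ => 0)

theorem IsPDKernel.abs_le_apply_zero {ψ : E → ℝ} (hψ : IsPDKernel fun x y : E => ψ (x - y))
    (x : E) : |ψ x| ≤ ψ 0 := by
  have h1 := hψ.2 2 ![1, 1] ![x, 0]
  have h2 := hψ.2 2 ![1, -1] ![x, 0]
  simp [Fin.sum_univ_two, hψ.even] at h1 h2
  exact abs_le.2 ⟨by linarith, by linarith⟩

variable [InnerProductSpace ℝ E]

/-- Apply positive definiteness with weights `cos⟨x_i, w⟩` and `sin⟨x_i, w⟩` and add, using the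
addition formula for the cosine. -/
theorem IsPDKernel.sum_mul_cos_nonneg {ψ : E → ℝ} (hψ : IsPDKernel fun x y : E => ψ (x - y))
    (w : E) (n : ℕ) (x : Fin n → E) :
    0 ≤ ∑ l, ∑ j, ψ (x l - x j) * Real.cos (inner ℝ (x l - x j) w) := by
  have h1 := hψ.2 n (fun i => Real.cos (inner ℝ (x i) w)) x
  have h2 := hψ.2 n (fun i => Real.sin (inner ℝ (x i) w)) x
  refine (add_nonneg h1 h2).trans_eq ?_
  simp_rw [← Finset.sum_add_distrib, inner_sub_left, Real.cos_sub]
  refine Finset.sum_congr rfl fun l _ => Finset.sum_congr rfl fun j _ => ?_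
  ring

variable [FiniteDimensional ℝ E] [MeasurableSpace E] [BorelSpace E]

theorem integrable_exp_neg_mul_norm_sq {a : ℝ} (ha : 0 < a) :
    Integrable fun x : E => Real.exp (-a * ‖x‖ ^ 2) := by
  have h := GaussianFourier.integrable_cexp_neg_mul_sq_norm_add (V := E) (b := (a : ℂ))
    (by simpa using ha) 0 0
  have h2 := h.re
  refine h2.congr (ae_of_all _ fun x => ?_)
  simp only [zero_mul, add_zero]
  have : (-(a : ℂ) * (‖x‖ : ℂ) ^ 2) = ((-a * ‖x‖ ^ 2 : ℝ) : ℂ) := by push_cast; ring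
  rw [this, ← Complex.ofReal_exp]
  exact Complex.ofReal_re _

/-- Integrate `K(x - y)` against `μ × μ` for `μ` Gaussian with density `exp(-2a‖x‖²)`; the law of
the difference is a positive multiple of `exp(-a‖u‖²)`. -/
theorem integral_mul_gaussian_nonneg {K : E → ℝ} (hK : Continuous K) {C : ℝ}
    (hC : ∀ u, |K u| ≤ C) (h : ∀ (n : ℕ) (x : Fin n → E), 0 ≤ ∑ l, ∑ j, K (x l - x j))
    {a : ℝ} (ha : 0 < a) : 0 ≤ ∫ u, K u * Real.exp (-a * ‖u‖ ^ 2) := by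
  set γ : E → ℝ := fun x => Real.exp (-(2 * a) * ‖x‖ ^ 2) with hγ
  have hγi : Integrable γ := integrable_exp_neg_mul_norm_sq (by positivity)
  have hγc : Continuous γ := by fun_prop
  have hγ0 : ∀ x, 0 ≤ γ x := fun x => (Real.exp_pos _).le
  set μ : Measure E := volume.withDensity fun x => ENNReal.ofReal (γ x) with hμ
  have : IsFiniteMeasure μ := isFiniteMeasure_withDensity_ofReal hγi.2
  have hint : ∀ f : E → ℝ, ∫ x, f x ∂μ = ∫ x, γ x * f x := by
    intro f
    have h := integral_withDensity_eq_integral_smul (μ := (volume : Measure E))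
      (f := fun x => (γ x).toNNReal) (by fun_prop) f
    simpa [NNReal.smul_def, hγ0, hμ, ENNReal.ofReal] using h
  have h0 := integral_prod_nonneg_of_sum_nonneg μ (K := fun p => K (p.1 - p.2))
    (by fun_prop) (fun p => hC _) h
  rw [integral_prod _ (Integrable.of_bound (by fun_prop) C (ae_of_all _ fun p => hC _)), hint] at h0
  simp_rw [hint] at h0
  have e1 : ∀ x, γ x * ∫ y, γ y * K (x - y) = ∫ u, γ x * (γ (u - x) * K u) := by
    intro x
    rw [integral_const_mul, ← integral_sub_left_eq_self (fun y => γ y * K (x - y)) volume x]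
    congr 1
    refine integral_congr_ae (ae_of_all _ fun u => ?_)
    simp only [sub_sub_cancel, hγ, norm_sub_rev x u]
  simp_rw [e1] at h0
  rw [integral_integral_swap] at h0
  swap
  · have hc := (Integrable.convolution_integrand (ContinuousLinearMap.mul ℝ ℝ) hγi hγi).swap
    have := hc.mul_bdd (g := fun p : E × E => K p.2) (c := C) (by fun_prop)
      (ae_of_all _ fun p => hC _)
    refine this.congr (ae_of_all _ fun p => ?_)
    simp [Function.uncurry, mul_assoc]
  set Z := ∫ x : E, Real.exp (-(4 * a) * ‖x‖ ^ 2) with hZ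
  have hZ0 : 0 < Z := by
    rw [hZ, GaussianFourier.integral_rexp_neg_mul_sq_norm (by positivity)]
    positivity
  -- Completing the square: `2a‖x‖² + 2a‖u - x‖² = 4a‖x - u/2‖² + a‖u‖²`.
  have e2 : ∀ u, ∫ x, γ x * (γ (u - x) * K u) = Z * (K u * Real.exp (-a * ‖u‖ ^ 2)) := by
    intro u
    rw [hZ, ← integral_sub_right_eq_self (fun x => Real.exp (-(4 * a) * ‖x‖ ^ 2))
      ((2 : ℝ)⁻¹ • u), ← integral_mul_const]
    refine integral_congr_ae (ae_of_all _ fun x => ?_)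
    simp only [hγ]
    rw [← mul_assoc, ← Real.exp_add, mul_left_comm, ← Real.exp_add, mul_comm]
    congr 2
    rw [@norm_sub_sq_real _ _ _ u x, @norm_sub_sq_real _ _ _ x ((2 : ℝ)⁻¹ • u), norm_smul,
      real_inner_smul_right, real_inner_comm]
    simp
    ring
  simp_rw [e2] at h0
  rw [integral_const_mul] at h0
  exact nonneg_of_mul_nonneg_right h0 hZ0

theorem IsPDKernel.integral_mul_cos_mul_gaussian_nonneg {ψ : E → ℝ} (hc : Continuous ψ)
    (hψ : IsPDKernel fun x y : E => ψ (x - y)) (w : E) {a : ℝ} (ha : 0 < a) :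
    0 ≤ ∫ u, ψ u * Real.cos (inner ℝ u w) * Real.exp (-a * ‖u‖ ^ 2) := by
  refine integral_mul_gaussian_nonneg (K := fun u => ψ u * Real.cos (inner ℝ u w)) (by fun_prop)
    (C := ψ 0) (fun u => ?_) (hψ.sum_mul_cos_nonneg w) ha
  rw [abs_mul]
  exact (mul_le_of_le_one_right (abs_nonneg _) (Real.abs_cos_le_one _)).trans
    (hψ.abs_le_apply_zero u)

theorem IsPDKernel.integral_mul_cos_nonneg {ψ : E → ℝ} (hc : Continuous ψ) (hi : Integrable ψ)
    (hψ : IsPDKernel fun x y : E => ψ (x - y)) (w : E) :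
    0 ≤ ∫ u, ψ u * Real.cos (inner ℝ u w) := by
  have ht : Tendsto (fun n : ℕ => ∫ u, ψ u * Real.cos (inner ℝ u w) *
      Real.exp (-(1 / ((n : ℝ) + 1)) * ‖u‖ ^ 2)) atTop
      (𝓝 (∫ u, ψ u * Real.cos (inner ℝ u w))) := by
    refine tendsto_integral_of_dominated_convergence (fun u => |ψ u|) (fun n => by fun_prop)
      hi.abs (fun n => ae_of_all _ fun u => ?_) (ae_of_all _ fun u => ?_)
    · rw [norm_mul, norm_mul, Real.norm_eq_abs, Real.norm_eq_abs, Real.norm_eq_abs, Real.abs_exp]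
      have h1 := Real.abs_cos_le_one (inner ℝ u w)
      have h2 : Real.exp (-(1 / ((n : ℝ) + 1)) * ‖u‖ ^ 2) ≤ 1 := by
        rw [Real.exp_le_one_iff, neg_mul, neg_nonpos]
        positivity
      calc |ψ u| * |Real.cos (inner ℝ u w)| * Real.exp (-(1 / ((n : ℝ) + 1)) * ‖u‖ ^ 2)
          ≤ |ψ u| * 1 * 1 := by gcongr
        _ = _ := by ring
    · have h1 : Tendsto (fun n : ℕ => Real.exp (-(1 / ((n : ℝ) + 1)) * ‖u‖ ^ 2)) atTop
          (𝓝 (Real.exp (-0 * ‖u‖ ^ 2))) :=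
        (Real.continuous_exp.tendsto _).comp
          ((tendsto_one_div_add_atTop_nhds_zero_nat.neg).mul_const _)
      simpa using h1.const_mul (ψ u * Real.cos (inner ℝ u w))
  exact ge_of_tendsto' ht fun n =>
    hψ.integral_mul_cos_mul_gaussian_nonneg hc w (by positivity)

end Bochner

/-! ### Fourier inversion and Bochner's theorem -/

section Bochner

open scoped FourierTransform

variable {E : Type*} [NormedAddCommGroup E] [InnerProductSpace ℝ E]
  [FiniteDimensional ℝ E] [MeasurableSpace E] [BorelSpace E]

/-- The cosine transform of a real function. -/
noncomputable def cosTransform (h : E → ℝ) (w : E) : ℝ := ∫ u, h u * Real.cos (inner ℝ u w)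

theorem fourier_ofReal_of_even {h : E → ℝ} (hi : Integrable h) (he : ∀ x, h (-x) = h x) (w : E) :
    𝓕 (fun u => (h u : ℂ)) w = (cosTransform h ((2 * Real.pi) • w) : ℂ) := by
  have i₁ : Integrable fun u => h u * Real.cos (inner ℝ u ((2 * Real.pi) • w)) :=
    hi.mul_bdd (c := 1) (by fun_prop) (ae_of_all _ fun x => Real.abs_cos_le_one _)
  have i₂ : Integrable fun u => h u * Real.sin (inner ℝ u ((2 * Real.pi) • w)) :=
    hi.mul_bdd (c := 1) (by fun_prop) (ae_of_all _ fun x => Real.abs_sin_le_one _)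
  have hsin : ∫ u, h u * Real.sin (inner ℝ u ((2 * Real.pi) • w)) = 0 := by
    have := integral_neg_eq_self (fun u => h u * Real.sin (inner ℝ u ((2 * Real.pi) • w))) volume
    simp only [he, inner_neg_left, Real.sin_neg, mul_neg, integral_neg] at this
    linarith
  have hs : ∫ u, ((h u * Real.sin (inner ℝ u ((2 * Real.pi) • w)) : ℝ) : ℂ) * Complex.I = 0 := by
    rw [integral_mul_const, integral_complex_ofReal, hsin]
    simp
  rw [Real.fourier_eq', cosTransform, ← integral_complex_ofReal]
  refine Eq.trans ?_ (sub_zero _)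
  rw [← hs, ← integral_sub i₁.ofReal (i₂.ofReal.mul_const _)]
  refine integral_congr_ae (ae_of_all _ fun u => ?_)
  simp only [smul_eq_mul, Complex.exp_mul_I, real_inner_smul_right]
  rw [← Complex.ofReal_cos, ← Complex.ofReal_sin,
    show -2 * Real.pi * inner ℝ u w = -(2 * Real.pi * inner ℝ u w) by ring, Real.cos_neg,
    Real.sin_neg]
  push_cast
  ring

theorem continuous_cosTransform {h : E → ℝ} (hi : Integrable h) :
    Continuous (cosTransform h) := by
  refine continuous_of_dominated (bound := fun u => |h u|)
    (fun w => hi.1.mul (by fun_prop)) (fun w => ae_of_all _ fun u => ?_) hi.abs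
    (ae_of_all _ fun u => by fun_prop)
  rw [norm_mul]
  exact mul_le_of_le_one_right (abs_nonneg _) (Real.abs_cos_le_one _)

/-- Moving the transform onto the Gaussian, an approximate identity, shows that the
Gaussian-weighted integrals of `p` tend to `h 0`. As `p ≥ 0`, Fatou bounds `∫ p` by `h 0`. -/
theorem integrable_of_fourier_nonneg {h : E → ℂ} (hc : Continuous h) (hi : Integrable h)
    {p : E → ℝ} (hp : ∀ w, 0 ≤ p w) (hp' : Continuous p) (hF : ∀ w, 𝓕 h w = p w) :
    Integrable p := by
  have hb : ∀ n : ℕ, 0 < 1 / ((n : ℝ) + 1) := fun n => by positivity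
  set g : ℕ → E → ℝ := fun n w => Real.exp (-(1 / ((n : ℝ) + 1)) * ‖w‖ ^ 2) * p w with hg
  have hpb : ∀ w, ‖p w‖ ≤ ∫ u, ‖h u‖ := fun w => by
    have := VectorFourier.norm_fourierIntegral_le_integral_norm 𝐞 volume (innerₗ E) h w
    have h2 : ‖𝓕 h w‖ ≤ ∫ u, ‖h u‖ := this
    rwa [hF, Complex.norm_real] at h2
  have hgi : ∀ n, Integrable (g n) := fun n =>
    (integrable_exp_neg_mul_norm_sq (hb n)).mul_bdd (by fun_prop) (ae_of_all _ hpb)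
  have hg0 : ∀ n w, 0 ≤ g n w := fun n w => mul_nonneg (Real.exp_pos _).le (hp w)
  have hlim : Tendsto (fun n => ∫ w, g n w) atTop (𝓝 (h 0).re) := by
    have h1 := (Real.tendsto_integral_gaussian_smul' hi (v := 0) hc.continuousAt).comp
      (tendsto_atTop_add_const_right atTop (1 : ℝ) tendsto_natCast_atTop_atTop)
    have h2 := (Complex.continuous_re.tendsto _).comp h1
    refine h2.congr fun n => ?_
    have hbn : 0 < (((1 / ((n : ℝ) + 1) : ℝ)) : ℂ).re := by
      rw [Complex.ofReal_re]
      exact hb n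
    have hgauss : Integrable fun v : E =>
        Complex.exp (-((1 / ((n : ℝ) + 1) : ℝ) : ℂ) * (‖v‖ : ℂ) ^ 2) := by
      simpa using GaussianFourier.integrable_cexp_neg_mul_sq_norm_add (V := E) hbn 0 0
    have hadj := VectorFourier.integral_fourierIntegral_smul_eq_flip (L := innerₗ E)
      (μ := volume) (ν := volume) Real.continuous_fourierChar continuous_inner hgauss hi
    rw [flip_innerₗ] at hadj
    change ∫ ξ, 𝓕 (fun v : E => Complex.exp (-((1 / ((n : ℝ) + 1) : ℝ) : ℂ) * (‖v‖ : ℂ) ^ 2)) ξ •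
      h ξ = ∫ x, _ • 𝓕 h x at hadj
    have hcast : ∫ w, ((g n w : ℝ) : ℂ) = ((∫ w, g n w : ℝ) : ℂ) := integral_complex_ofReal
    rw [← Complex.ofReal_re (∫ w, g n w), ← hcast]
    simp only [Function.comp_apply]
    congr 1
    refine Eq.trans ?_ (hadj.trans ?_)
    · refine integral_congr_ae (ae_of_all _ fun w => ?_)
      simp only
      rw [fourier_gaussian_innerProductSpace hbn]
      congr 2
      · push_cast
        congr 1
        field_simp
      · congr 1
        push_cast
        rw [zero_sub, norm_neg]
        field_simp
    · refine integral_congr_ae (ae_of_all _ fun w => ?_)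
      simp only [hF, hg, smul_eq_mul]
      push_cast
      rfl
  have hfat : ∫⁻ w, ENNReal.ofReal (p w) ≤ ENNReal.ofReal (h 0).re := by
    have h1 := lintegral_liminf_le (μ := (volume : Measure E)) (u := atTop)
      (f := fun n w => ENNReal.ofReal (g n w)) fun n => by
        have := (hgi n).1; simp only [hg]; fun_prop
    have h2 : Tendsto (fun n => ∫⁻ w, ENNReal.ofReal (g n w)) atTop
        (𝓝 (ENNReal.ofReal (h 0).re)) := by
      simp_rw [fun n => (ofReal_integral_eq_lintegral_ofReal (hgi n) (ae_of_all _ (hg0 n))).symm]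
      exact ENNReal.tendsto_ofReal hlim
    rw [h2.liminf_eq] at h1
    refine le_trans (le_of_eq (lintegral_congr fun w => ?_)) h1
    refine (Tendsto.liminf_eq ?_).symm
    refine ENNReal.tendsto_ofReal ?_
    have h3 : Tendsto (fun n : ℕ => Real.exp (-(1 / ((n : ℝ) + 1)) * ‖w‖ ^ 2)) atTop
        (𝓝 (Real.exp (-0 * ‖w‖ ^ 2))) :=
      (Real.continuous_exp.tendsto _).comp
        ((tendsto_one_div_add_atTop_nhds_zero_nat.neg).mul_const _)
    simpa [hg] using h3.mul_const (p w)
  refine ⟨hp'.aestronglyMeasurable, ?_⟩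
  rw [hasFiniteIntegral_iff_ofReal (ae_of_all _ hp)]
  exact hfat.trans_lt ENNReal.ofReal_lt_top

/-- The measure whose density is the (rescaled) cosine transform of an integrable function. -/
noncomputable def cosTransformMeasure (h : E → ℝ) : Measure E :=
  (volume.withDensity fun w => ENNReal.ofReal (cosTransform h ((2 * Real.pi) • w))).map
    ((2 * Real.pi) • ·)

/-- Fourier inversion; the dilation by 2π converts between the normalisations of `𝓕` and `charFun`.
-/
theorem isFiniteMeasure_and_charFun_cosTransformMeasure {h : E → ℝ} (hc : Continuous h)
    (hi : Integrable h) (he : ∀ x, h (-x) = h x) (hpos : ∀ w, 0 ≤ cosTransform h w) :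
    IsFiniteMeasure (cosTransformMeasure h) ∧ ∀ t, charFun (cosTransformMeasure h) t = h t := by
  have hpc : Continuous fun w : E => cosTransform h ((2 * Real.pi) • w) :=
    (continuous_cosTransform hi).comp (continuous_const_smul _)
  have hF := fourier_ofReal_of_even hi he
  have hcc : Continuous fun u => (h u : ℂ) := by fun_prop
  have hpi : Integrable fun w : E => cosTransform h ((2 * Real.pi) • w) :=
    integrable_of_fourier_nonneg hcc hi.ofReal (fun w => hpos _) hpc hF
  have fin : IsFiniteMeasure (volume.withDensity fun w : E =>
      ENNReal.ofReal (cosTransform h ((2 * Real.pi) • w))) := isFiniteMeasure_withDensity_ofReal hpi.2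
  refine ⟨by unfold cosTransformMeasure; infer_instance, fun t => ?_⟩
  have hFi : Integrable (𝓕 fun u => (h u : ℂ)) := hpi.ofReal.congr (ae_of_all _ fun w => (hF w).symm)
  have hinv := congrFun (hcc.fourierInv_fourier_eq hi.ofReal hFi) t
  rw [cosTransformMeasure, charFun_map_smul, charFun_withDensity_ofReal hpc.measurable, ← hinv,
    Real.fourierInv_eq']
  refine integral_congr_ae (ae_of_all _ fun w => ?_)
  simp only [hF, smul_eq_mul, max_eq_left (hpos _), real_inner_smul_right]
  ring

/-- **Bochner's theorem** for real positive definite functions. -/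
theorem IsPDKernel.exists_charFun_eq {ψ : E → ℝ} (hc : Continuous ψ)
    (hψ : IsPDKernel fun x y : E => ψ (x - y)) (h0 : 0 < ψ 0) :
    ∃ Λ : Measure E, IsFiniteMeasure Λ ∧ ∀ t, charFun Λ t = ψ t := by
  set h : ℕ → E → ℝ := fun n u => ψ u * Real.exp (-(1 / ((n : ℝ) + 1)) * ‖u‖ ^ 2) with hh
  have hhc : ∀ n, Continuous (h n) := fun n => by fun_prop
  have hhi : ∀ n, Integrable (h n) := fun n => by
    refine ((integrable_exp_neg_mul_norm_sq (E := E) (a := 1 / ((n : ℝ) + 1))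
      (by positivity)).bdd_mul (c := ψ 0) (by fun_prop) (ae_of_all _ hψ.abs_le_apply_zero))
  have hhe : ∀ n x, h n (-x) = h n x := fun n x => by simp [hh, hψ.even]
  have hpos : ∀ n w, 0 ≤ cosTransform (h n) w := fun n w => by
    refine (hψ.integral_mul_cos_mul_gaussian_nonneg hc w
      (a := 1 / ((n : ℝ) + 1)) (by positivity)).trans_eq ?_
    refine integral_congr_ae (ae_of_all _ fun u => ?_)
    simp only [hh]
    ring
  have hΛ := fun n => isFiniteMeasure_and_charFun_cosTransformMeasure (hhc n) (hhi n) (hhe n) (hpos n)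
  have hmass : ∀ n, (cosTransformMeasure (h n)) Set.univ = ENNReal.ofReal (ψ 0) := fun n => by
    have := (hΛ n).1
    have h1 := (hΛ n).2 0
    rw [charFun_zero] at h1
    have h2 : (cosTransformMeasure (h n)).real Set.univ = ψ 0 := by
      have := Complex.ofReal_injective h1
      simpa [hh] using this
    rw [← h2, ofReal_measureReal]
  set c := ENNReal.ofReal (ψ 0) with hcdef
  have hc0 : c ≠ 0 := by simpa [hcdef] using h0
  have hct : c ≠ ⊤ := ENNReal.ofReal_ne_top
  let μ : ℕ → ProbabilityMeasure E := fun n => ⟨c⁻¹ • cosTransformMeasure (h n),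
    ⟨by rw [Measure.smul_apply, hmass, smul_eq_mul, ENNReal.inv_mul_cancel hc0 hct]⟩⟩
  have hμ : ∀ n t, charFun (μ n : Measure E) t = ((ψ 0)⁻¹ * h n t : ℝ) := fun n t => by
    change charFun (c⁻¹ • cosTransformMeasure (h n)) t = _
    rw [charFun_apply, integral_smul_measure, ← charFun_apply, (hΛ n).2, hcdef,
      ENNReal.toReal_inv, ENNReal.toReal_ofReal h0.le, Complex.real_smul]
    push_cast
    rfl
  have hlim : ∀ t, Tendsto (fun n => charFun (μ n : Measure E) t) atTop
      (𝓝 (((ψ 0)⁻¹ * ψ t : ℝ) : ℂ)) := fun t => by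
    simp_rw [hμ]
    refine (Complex.continuous_ofReal.tendsto _).comp (Tendsto.const_mul _ ?_)
    have h3 : Tendsto (fun n : ℕ => Real.exp (-(1 / ((n : ℝ) + 1)) * ‖t‖ ^ 2)) atTop
        (𝓝 (Real.exp (-0 * ‖t‖ ^ 2))) :=
      (Real.continuous_exp.tendsto _).comp
        ((tendsto_one_div_add_atTop_nhds_zero_nat.neg).mul_const _)
    simpa [hh] using h3.const_mul (ψ t)
  -- Pointwise convergence of characteristic functions to a continuous limit forces tightness, so
  -- Prokhorov applies. A limit along an ultrafilter finer than `atTop` replaces a convergent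
  -- subsequence.
  have htight := isTightMeasureSet_of_tendsto_charFun (μ := fun n => (μ n : Measure E))
    (f := fun t => (((ψ 0)⁻¹ * ψ t : ℝ) : ℂ)) (by fun_prop) hlim
  have hcomp := isCompact_closure_of_isTightMeasureSet (S := Set.range μ) (by
    refine htight.subset ?_
    rintro _ ⟨_, ⟨n, rfl⟩, rfl⟩
    exact ⟨n, rfl⟩)
  obtain ⟨ν, -, hν⟩ := hcomp.ultrafilter_le_nhds
    ((Ultrafilter.of (atTop : Filter ℕ)).map μ) (by
      refine le_principal_iff.2 (mem_of_superset ?_ subset_closure)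
      exact Ultrafilter.mem_coe.2 (Ultrafilter.mem_map.2 (Filter.univ_mem' fun n => ⟨n, rfl⟩)))
  have hconv : Tendsto μ (Ultrafilter.of (atTop : Filter ℕ)) (𝓝 ν) := hν
  have hν' : ∀ t, charFun (ν : Measure E) t = (((ψ 0)⁻¹ * ψ t : ℝ) : ℂ) := fun t => by
    have h1 := (ProbabilityMeasure.tendsto_iff_forall_integral_rclike_tendsto ℂ).1 hconv
      (BoundedContinuousFunction.innerProbChar t)
    simp_rw [← charFun_eq_integral_innerProbChar] at h1
    exact tendsto_nhds_unique h1 ((hlim t).mono_left (Ultrafilter.of_le _))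
  refine ⟨c • (ν : Measure E), Measure.smul_finite _ hct, fun t => ?_⟩
  rw [charFun_apply, integral_smul_measure, ← charFun_apply, hν', hcdef,
    ENNReal.toReal_ofReal h0.le, Complex.real_smul, ← Complex.ofReal_mul]
  congr 1
  field_simp

end Bochner

/-! ### Functionals on `C(Z)` and `cc`-universality -/

section CompactConvergence

theorem exp_apply_continuousMap {Z : Type*} [TopologicalSpace Z] [CompactSpace Z]
    (a : C(Z, ℂ)) (z : Z) :
    NormedSpace.exp a z = Complex.exp (a z) := by
  have h := NormedSpace.map_exp (ContinuousMap.evalAlgHom ℂ ℂ z)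
    (continuous_eval_const z) a
  rw [Complex.exp_eq_exp_ℂ]
  exact h

variable {E : Type*} [NormedAddCommGroup E] [InnerProductSpace ℝ E]

/-- The character `z ↦ exp(i⟪z, w⟫)` restricted to `Z`. -/
noncomputable def restrictedCharacter (Z : Set E) (w : E) : C(Z, ℂ) :=
  ⟨fun z => Complex.exp ((inner ℝ (z : E) w : ℝ) * Complex.I), by fun_prop⟩

theorem restrictedCharacter_apply (Z : Set E) (w : E) (z : Z) :
    restrictedCharacter Z w z = Complex.exp ((inner ℝ (z : E) w : ℝ) * Complex.I) := rfl

theorem restrictedCharacter_add (Z : Set E) (v w : E) :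
    restrictedCharacter Z (v + w) = restrictedCharacter Z v * restrictedCharacter Z w := by
  ext z
  simp only [ContinuousMap.mul_apply, restrictedCharacter_apply, inner_add_right]
  rw [← Complex.exp_add]
  push_cast
  ring_nf

theorem continuous_restrictedCharacter (Z : Set E) : Continuous (restrictedCharacter Z) :=
  ContinuousMap.continuous_of_continuous_uncurry _ (by
    simp only [Function.uncurry_def, restrictedCharacter_apply]
    fun_prop)

variable {Z : Set E} [CompactSpace Z]

theorem norm_restrictedCharacter_le (w : E) : ‖restrictedCharacter Z w‖ ≤ 1 :=
  (ContinuousMap.norm_le _ zero_le_one).2 fun z => by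
    rw [restrictedCharacter_apply, Complex.norm_exp_ofReal_mul_I]

theorem restrictedCharacter_smul_eq_exp (v : E) (t : ℝ) :
    restrictedCharacter Z (t • v) = NormedSpace.exp
      (t • (⟨fun z => (inner ℝ (z : E) v : ℝ) * Complex.I, by fun_prop⟩ : C(Z, ℂ))) := by
  ext z
  rw [exp_apply_continuousMap, restrictedCharacter_apply, real_inner_smul_right]
  simp only [ContinuousMap.smul_apply, ContinuousMap.coe_mk, Complex.real_smul]
  push_cast
  ring_nf

/-- A functional on `C(Z, ℂ)` which vanishes on the characters of an open set of frequencies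
vanishes on all characters. -/
theorem functional_restrictedCharacter_eq_zero (L : C(Z, ℂ) →L[ℂ] ℂ) {U : Set E} (hU : IsOpen U)
    (hne : U.Nonempty) (h : ∀ w ∈ U, L (restrictedCharacter Z w) = 0) (w : E) :
    L (restrictedCharacter Z w) = 0 := by
  obtain ⟨w₀, hw₀⟩ := hne
  set a : C(Z, ℂ) := ⟨fun z => (inner ℝ (z : E) (w - w₀) : ℝ) * Complex.I, by fun_prop⟩ with ha
  -- `F` is `L` on the characters along the line from `w₀` (`t = 0`) to `w` (`t = 1`). It is
  -- analytic because these form a translate of a one-parameter group in the Banach algebra `C(Z,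
  -- ℂ)`, so the identity theorem on `ℝ` applies.
  let F : ℝ → ℂ := fun t => L (restrictedCharacter Z w₀ * NormedSpace.exp (t • a))
  have hF : ∀ t, F t = L (restrictedCharacter Z (w₀ + t • (w - w₀))) := fun t => by
    rw [restrictedCharacter_add, restrictedCharacter_smul_eq_exp]
  let M : C(Z, ℂ) →L[ℝ] ℂ :=
    (L.comp (ContinuousLinearMap.mul ℂ C(Z, ℂ) (restrictedCharacter Z w₀))).restrictScalars ℝ
  have hexp : AnalyticOnNhd ℝ (fun b : C(Z, ℂ) => NormedSpace.exp b) Set.univ := fun b _ =>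
    NormedSpace.exp_analytic (𝕂 := ℝ) b
  have hlin : AnalyticOnNhd ℝ (fun t : ℝ => t • a) Set.univ := fun t _ =>
    ((ContinuousLinearMap.id ℝ ℝ).smulRight a).analyticAt t
  have hFan : AnalyticOnNhd ℝ F Set.univ :=
    M.comp_analyticOnNhd (hexp.comp hlin (Set.mapsTo_univ _ _))
  have hev : F =ᶠ[𝓝 0] 0 := by
    have hc : Continuous fun t : ℝ => w₀ + t • (w - w₀) := by fun_prop
    have hmem : (fun t : ℝ => w₀ + t • (w - w₀)) ⁻¹' U ∈ 𝓝 0 :=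
      (hU.preimage hc).mem_nhds (by simpa using hw₀)
    filter_upwards [hmem] with t ht
    rw [hF]
    exact h _ ht
  have := hFan.eqOn_zero_of_preconnected_of_eventuallyEq_zero isPreconnected_univ
    (Set.mem_univ 0) hev (Set.mem_univ 1)
  rw [hF] at this
  simpa using this

/-- Stone–Weierstrass: the span of the characters is already a unital star-subalgebra, and it
separates points. -/
theorem functional_eq_zero_of_restrictedCharacter (L : C(Z, ℂ) →L[ℂ] ℂ)
    (h : ∀ w, L (restrictedCharacter Z w) = 0) : L = 0 := by
  set S := Submodule.span ℂ (Set.range (restrictedCharacter Z)) with hS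
  have hone : (1 : C(Z, ℂ)) ∈ S := Submodule.subset_span ⟨0, by
    ext z; simp [restrictedCharacter_apply]⟩
  have hmul : ∀ f g, f ∈ S → g ∈ S → f * g ∈ S := by
    intro f g hf hg
    have h1 : f * g ∈ S * S := Submodule.mul_mem_mul hf hg
    rw [hS, Submodule.span_mul_span] at h1
    refine Submodule.span_le.2 ?_ h1
    rintro _ ⟨_, ⟨v, rfl⟩, _, ⟨w, rfl⟩, rfl⟩
    exact Submodule.subset_span ⟨v + w, restrictedCharacter_add Z v w⟩
  have hstar : ∀ {f}, f ∈ S → star f ∈ S := by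
    intro f hf
    induction hf using Submodule.span_induction with
    | mem _ h =>
      obtain ⟨w, rfl⟩ := h
      refine Submodule.subset_span ⟨-w, ?_⟩
      ext z
      simp [restrictedCharacter_apply, ← Complex.exp_conj]
    | zero => simp
    | add f g _ _ hf hg => rw [star_add]; exact S.add_mem hf hg
    | smul c f _ hf => rw [star_smul]; exact S.smul_mem _ hf
  let A : StarSubalgebra ℂ C(Z, ℂ) :=
    { S.toSubalgebra hone hmul with star_mem' := hstar }
  have hsep : A.SeparatesPoints := by
    intro x y hxy
    have hne : (x : E) - y ≠ 0 := sub_ne_zero.2 fun h => hxy (Subtype.ext h)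
    by_contra hcon
    push Not at hcon
    have hall : ∀ w : E, restrictedCharacter Z w x = restrictedCharacter Z w y := fun w =>
      hcon _ ⟨restrictedCharacter Z w, Submodule.subset_span ⟨w, rfl⟩, rfl⟩
    refine hxy (Subtype.ext ?_)
    refine BoundedContinuousFunction.ext_of_char_eq Real.continuous_probChar
      Real.probChar_ne_one (L := innerₗ E) continuous_inner
      (fun v hv => DFunLike.ne_iff.mpr ⟨v, inner_self_ne_zero.mpr hv⟩) fun w => hall w
  have htop := ContinuousMap.starSubalgebra_topologicalClosure_eq_top_of_separatesPoints A hsep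
  ext f
  have hf : f ∈ closure (A : Set C(Z, ℂ)) := by
    rw [← StarSubalgebra.topologicalClosure_coe, htop]
    trivial
  have hclosed : IsClosed {g : C(Z, ℂ) | L g = 0} := isClosed_eq L.continuous continuous_const
  refine closure_minimal (fun g hg => ?_) hclosed hf
  have hle : S ≤ L.toLinearMap.ker := by
    rw [hS, Submodule.span_le]
    rintro _ ⟨w, rfl⟩
    exact h w
  exact hle hg

variable [FiniteDimensional ℝ E] [MeasurableSpace E] [BorelSpace E]

/-- The section is a Bochner integral of characters in `C(Z, ℂ)`, through which `L` passes. -/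
theorem functional_section_eq_integral {Λ : Measure E} [IsFiniteMeasure Λ] {ψ : E → ℝ}
    (hΛ : ∀ t, charFun Λ t = ψ t) (L : C(Z, ℂ) →L[ℂ] ℂ) (y : E) (s : C(Z, ℂ))
    (hs : ∀ z : Z, s z = ψ (z - y)) :
    L s = ∫ w, L (restrictedCharacter Z w) *
      Complex.exp ((inner ℝ w (-y) : ℝ) * Complex.I) ∂Λ := by
  have hi : Integrable (fun w => Complex.exp ((inner ℝ w (-y) : ℝ) * Complex.I) •
      restrictedCharacter Z w) Λ := by
    have hc := continuous_restrictedCharacter Z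
    refine Integrable.of_bound (Continuous.aestronglyMeasurable (by fun_prop)) 1
      (ae_of_all _ fun w => ?_)
    rw [norm_smul, Complex.norm_exp_ofReal_mul_I, one_mul]
    exact norm_restrictedCharacter_le w
  have hsi : s = ∫ w, Complex.exp ((inner ℝ w (-y) : ℝ) * Complex.I) •
      restrictedCharacter Z w ∂Λ := by
    ext z
    have h1 := (ContinuousMap.evalCLM ℂ z).integral_comp_comm hi
    refine Eq.trans ?_ h1
    rw [hs, ← hΛ, charFun_apply]
    refine integral_congr_ae (ae_of_all _ fun w => ?_)
    simp only [ContinuousMap.evalCLM_apply, ContinuousMap.smul_apply, smul_eq_mul,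
      restrictedCharacter_apply]
    rw [← Complex.exp_add, inner_sub_right, inner_neg_right, real_inner_comm (z : E) w]
    push_cast
    ring_nf
  rw [hsi, ← L.integral_comp_comm hi]
  refine integral_congr_ae (ae_of_all _ fun w => ?_)
  simp only [map_smul, smul_eq_mul]
  ring

theorem isCCUniversal_of_nonempty_interior_support {ψ : E → ℝ} (hc : Continuous ψ)
    (hψ : IsPDKernel fun x y : E => ψ (x - y)) {Λ : Measure E} [IsFiniteMeasure Λ]
    (hΛ : ∀ t, charFun Λ t = ψ t) (hne : (interior Λ.support).Nonempty) :
    IsCCUniversal fun x y : E => ψ (x - y) := by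
  refine ⟨hψ, by fun_prop, fun Z hZ g ε hε => ?_⟩
  have : CompactSpace Z := isCompact_iff_compactSpace.1 hZ
  let v : E → C(Z, ℂ) := fun y => ⟨fun z => (ψ (z - y) : ℂ), by fun_prop⟩
  have hdense := mem_closure_span_of_forall_dual (S := Set.range v) (fun L hL => by
    refine functional_eq_zero_of_restrictedCharacter L
      (functional_restrictedCharacter_eq_zero L isOpen_interior hne fun w hw => ?_)
    have hLc : Continuous fun w => L (restrictedCharacter Z w) :=
      L.continuous.comp (continuous_restrictedCharacter Z)
    refine eq_zero_of_mem_support_of_ae_eq_zero hLc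
      (ae_eq_zero_of_integral_mul_character_eq_zero hLc.measurable ?_ fun t => ?_)
      (interior_subset hw)
    · refine Integrable.of_bound hLc.aestronglyMeasurable ‖L‖ (ae_of_all _ fun w => ?_)
      exact L.le_of_opNorm_le_of_le le_rfl (norm_restrictedCharacter_le w) |>.trans_eq (mul_one _)
    · have := functional_section_eq_integral hΛ L (-t) (v (-t)) fun z => rfl
      rw [hL _ ⟨-t, rfl⟩, neg_neg] at this
      exact this.symm) (⟨fun z => (g z : ℂ), by fun_prop⟩ : C(Z, ℂ))
  obtain ⟨s, hs, hgs⟩ := Metric.mem_closure_iff.1 hdense ε hε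
  -- As `g` is real, taking the real part of the complex approximant does not increase the error.
  obtain ⟨⟨f, hf, hfs⟩, -⟩ := exists_rkhs_re_im hψ (ContinuousMap.coeFnLinearMap ℂ)
    (fun z : Z => (z : E)) v (fun y z => rfl) hs
  refine ⟨f, hf, fun z => ?_⟩
  rw [hfs z, abs_sub_comm]
  have h1 := (ContinuousMap.dist_apply_le_dist (f := (⟨fun z => (g z : ℂ), by fun_prop⟩ : C(Z, ℂ)))
    (g := s) z).trans hgs.le
  rw [dist_eq_norm] at h1
  have h2 := (Complex.abs_re_le_norm _).trans h1
  simpa using h2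

end CompactConvergence

/-! ### Functionals on `C₀` and sufficiency of full support -/

section VanishingAtInfinity

namespace ZeroAtInftyContinuousMap

theorem norm_apply_le_norm {X : Type*} [TopologicalSpace X] (f : C₀(X, ℂ)) (x : X) :
    ‖f x‖ ≤ ‖f‖ := by
  rw [← norm_toBCF_eq_norm]
  exact f.toBCF.norm_coe_le_norm x

theorem norm_le_of_forall {X : Type*} [TopologicalSpace X] (f : C₀(X, ℂ)) {C : ℝ} (hC : 0 ≤ C)
    (h : ∀ x, ‖f x‖ ≤ C) : ‖f‖ ≤ C := by
  rw [← norm_toBCF_eq_norm]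
  exact (BoundedContinuousFunction.norm_le hC).2 h

/-- A continuous function which vanishes outside a ball, as an element of `C₀`. -/
noncomputable def ofEqZero {E : Type*} [NormedAddCommGroup E] [ProperSpace E] (f : E → ℂ)
    (hf : Continuous f) (R : ℝ) (h : ∀ x, R ≤ ‖x‖ → f x = 0) : C₀(E, ℂ) where
  toFun := f
  continuous_toFun := hf
  zero_at_infty' := by
    refine tendsto_const_nhds.congr' ?_
    filter_upwards [(isCompact_closedBall (0 : E) R).compl_mem_cocompact] with x hx
    refine (h x ?_).symm
    simp at hx
    exact hx.le

end ZeroAtInftyContinuousMap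

open ZeroAtInftyContinuousMap

theorem exists_norm_lt_of_tendsto_cocompact {E : Type*} [NormedAddCommGroup E] {f : E → ℂ}
    (hf : Tendsto f (cocompact E) (𝓝 0)) {ε : ℝ} (hε : 0 < ε) :
    ∃ R : ℝ, ∀ x, R < ‖x‖ → ‖f x‖ < ε := by
  have h1 := hf.norm.eventually (gt_mem_nhds (show ‖(0 : ℂ)‖ < ε by simpa using hε))
  obtain ⟨K, hK, hKs⟩ := mem_cocompact.1 h1
  obtain ⟨R, hR⟩ := hK.isBounded.subset_closedBall (0 : E)
  refine ⟨R, fun x hx => hKs fun hxK => ?_⟩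
  have := hR hxK
  simp at this
  linarith

/-- A bounded functional on `C₀` is concentrated on a large ball. -/
theorem exists_norm_functional_le_of_eq_zero {E : Type*} [NormedAddCommGroup E]
    (L : C₀(E, ℂ) →L[ℂ] ℂ) {ε : ℝ} (hε : 0 < ε) :
    ∃ R : ℝ, ∀ g : C₀(E, ℂ), ‖g‖ ≤ 1 → (∀ x, ‖x‖ ≤ R → g x = 0) → ‖L g‖ ≤ ε := by
  -- Take `f` in the unit ball with `‖L f‖ > ‖L‖ - δ`, smaller than `δ` off a ball. If `g` vanishes
  -- on that ball, then after rotating phases `f + g` has norm at most `1 + δ` while `L` adds up, so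
  -- `‖L f‖ + ‖L g‖ ≤ ‖L‖(1 + δ)` and `‖L g‖ ≤ δ(1 + ‖L‖) = ε`.
  set δ := ε / (1 + ‖L‖) with hδ
  have hδ0 : 0 < δ := by positivity
  obtain ⟨f, hf1, hfL⟩ := L.exists_lt_apply_of_lt_opNorm (show ‖L‖ - δ < ‖L‖ by linarith)
  obtain ⟨R, hR⟩ := exists_norm_lt_of_tendsto_cocompact (zero_at_infty f) hδ0
  refine ⟨R, fun g hg1 hg0 => ?_⟩
  have hrot : ∀ z : ℂ, ∃ c : ℂ, ‖c‖ ≤ 1 ∧ c * z = (‖z‖ : ℂ) := fun z => by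
    rcases eq_or_ne z 0 with rfl | hz
    · exact ⟨0, by simp⟩
    · refine ⟨‖z‖ / z, ?_, div_mul_cancel₀ _ hz⟩
      rw [norm_div, Complex.norm_real, norm_norm, div_self (norm_ne_zero_iff.2 hz)]
  obtain ⟨c, hc1, hc⟩ := hrot (L f)
  obtain ⟨d, hd1, hd⟩ := hrot (L g)
  have hnorm : ‖c • f + d • g‖ ≤ 1 + δ := by
    refine norm_le_of_forall _ (by positivity) fun x => ?_
    have hcf : ‖c * f x‖ ≤ ‖f x‖ := by
      rw [norm_mul]; exact mul_le_of_le_one_left (norm_nonneg _) hc1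
    have hdg : ‖d * g x‖ ≤ ‖g x‖ := by
      rw [norm_mul]; exact mul_le_of_le_one_left (norm_nonneg _) hd1
    have hx : ‖f x‖ + ‖g x‖ ≤ 1 + δ := by
      rcases le_or_gt ‖x‖ R with h | h
      · rw [hg0 x h, norm_zero, add_zero]
        linarith [norm_apply_le_norm f x]
      · linarith [hR x h, (norm_apply_le_norm g x).trans hg1]
    change ‖c * f x + d * g x‖ ≤ 1 + δ
    exact (norm_add_le _ _).trans (by linarith)
  have hL : L (c • f + d • g) = ((‖L f‖ + ‖L g‖ : ℝ) : ℂ) := by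
    rw [map_add, map_smul, map_smul, smul_eq_mul, smul_eq_mul, hc, hd]
    push_cast
    rfl
  have h1 := L.le_of_opNorm_le_of_le le_rfl hnorm
  rw [hL, Complex.norm_real, Real.norm_of_nonneg (by positivity)] at h1
  have h2 : δ * (1 + ‖L‖) = ε := by rw [hδ]; field_simp
  linarith

/-- A continuous cutoff function, equal to one on the ball of radius `n` and to zero outside the
ball of radius `n + 1`. -/
noncomputable def radialCutoff {E : Type*} [NormedAddCommGroup E] (n : ℕ) (x : E) : ℝ :=
  max 0 (min 1 (n + 1 - ‖x‖))

variable {E : Type*} [NormedAddCommGroup E]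

theorem continuous_radialCutoff (n : ℕ) : Continuous (radialCutoff n : E → ℝ) := by
  unfold radialCutoff; fun_prop

theorem radialCutoff_nonneg (n : ℕ) (x : E) : 0 ≤ radialCutoff n x := le_max_left _ _

theorem radialCutoff_le_one (n : ℕ) (x : E) : radialCutoff n x ≤ 1 :=
  max_le zero_le_one (min_le_left _ _)

theorem radialCutoff_eq_one {n : ℕ} {x : E} (h : ‖x‖ ≤ n) : radialCutoff n x = 1 := by
  rw [radialCutoff, min_eq_left (by linarith), max_eq_right zero_le_one]

theorem radialCutoff_eq_zero {n : ℕ} {x : E} (h : n + 1 ≤ ‖x‖) : radialCutoff n x = 0 :=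
  max_eq_left ((min_le_right _ _).trans (by linarith))

variable [ProperSpace E]

/-- The product of an element of `C₀` with a radial cutoff function. -/
noncomputable def cutoffMul (n : ℕ) (f : C₀(E, ℂ)) : C₀(E, ℂ) :=
  ofEqZero (fun x => (radialCutoff n x : ℂ) * f x)
    ((Complex.continuous_ofReal.comp (continuous_radialCutoff n)).mul (map_continuous f)) (n + 1)
    fun x hx => by simp [radialCutoff_eq_zero hx]

theorem tendsto_cutoffMul (f : C₀(E, ℂ)) : Tendsto (fun n => cutoffMul n f) atTop (𝓝 f) := by
  rw [Metric.tendsto_atTop]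
  intro ε hε
  obtain ⟨R, hR⟩ := exists_norm_lt_of_tendsto_cocompact (zero_at_infty f) (half_pos hε)
  obtain ⟨N, hN⟩ := exists_nat_gt R
  refine ⟨N, fun n hn => ?_⟩
  rw [dist_eq_norm]
  refine (norm_le_of_forall _ (half_pos hε).le fun x => ?_).trans_lt (half_lt_self hε)
  have e : (cutoffMul n f - f) x = ((radialCutoff n x - 1 : ℝ) : ℂ) * f x := by
    change (radialCutoff n x : ℂ) * f x - f x = _
    push_cast
    ring
  rw [e, norm_mul, Complex.norm_real]
  rcases le_or_gt ‖x‖ n with h | h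
  · rw [radialCutoff_eq_one h]
    simp [(half_pos hε).le]
  · have h1 : ‖radialCutoff n x - 1‖ ≤ 1 := by
      rw [Real.norm_eq_abs, abs_le]
      constructor <;> linarith [radialCutoff_nonneg n x, radialCutoff_le_one n x]
    have h2 : R < ‖x‖ := hN.trans_le ((Nat.cast_le.2 hn).trans h.le)
    exact (mul_le_of_le_one_left (norm_nonneg _) h1).trans (hR x h2).le

variable [InnerProductSpace ℝ E]

/-- The product of a character with a radial cutoff function. -/
noncomputable def cutoffCharacter (n : ℕ) (w : E) : C₀(E, ℂ) :=
  ofEqZero (fun x => (radialCutoff n x : ℂ) * Complex.exp ((inner ℝ x w : ℝ) * Complex.I))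
    ((Complex.continuous_ofReal.comp (continuous_radialCutoff n)).mul (by fun_prop)) (n + 1)
    fun x hx => by simp [radialCutoff_eq_zero hx]

theorem cutoffCharacter_apply (n : ℕ) (w x : E) : cutoffCharacter n w x =
    (radialCutoff n x : ℂ) * Complex.exp ((inner ℝ x w : ℝ) * Complex.I) := rfl

theorem norm_cutoffCharacter_le (n : ℕ) (w : E) : ‖cutoffCharacter n w‖ ≤ 1 := by
  refine norm_le_of_forall _ zero_le_one fun x => ?_
  rw [cutoffCharacter_apply, norm_mul, Complex.norm_exp_ofReal_mul_I, mul_one, Complex.norm_real,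
    Real.norm_of_nonneg (radialCutoff_nonneg n x)]
  exact radialCutoff_le_one n x

/-- The cutoff confines `x` to the ball of radius `n + 1`, which is then a Lipschitz constant in the
frequency. -/
theorem continuous_cutoffCharacter (n : ℕ) :
    Continuous (cutoffCharacter n : E → C₀(E, ℂ)) := by
  refine (LipschitzWith.of_dist_le_mul (K := n + 1) fun v w => ?_).continuous
  rw [dist_eq_norm, dist_eq_norm]
  refine norm_le_of_forall _ (by positivity) fun x => ?_
  have e : (cutoffCharacter n v - cutoffCharacter n w) x = (radialCutoff n x : ℂ) *
      (Complex.exp ((inner ℝ x w : ℝ) * Complex.I) *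
        (Complex.exp (Complex.I * (inner ℝ x (v - w) : ℝ)) - 1)) := by
    change cutoffCharacter n v x - cutoffCharacter n w x = _
    rw [cutoffCharacter_apply, cutoffCharacter_apply, mul_sub, ← Complex.exp_add, inner_sub_right, mul_one, mul_sub]
    push_cast
    ring_nf
  rw [e, norm_mul, norm_mul, Complex.norm_exp_ofReal_mul_I, one_mul, Complex.norm_real,
    Real.norm_of_nonneg (radialCutoff_nonneg n x)]
  push_cast
  rcases le_or_gt (n + 1 : ℝ) ‖x‖ with h | h
  · rw [radialCutoff_eq_zero h, zero_mul]
    positivity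
  · have h1 := Real.norm_exp_I_mul_ofReal_sub_one_le (x := inner ℝ x (v - w))
    have h2 : ‖inner ℝ x (v - w)‖ ≤ ‖x‖ * ‖v - w‖ := norm_inner_le_norm _ _
    have h3 : ‖x‖ * ‖v - w‖ ≤ (n + 1) * ‖v - w‖ := by gcongr
    exact (mul_le_of_le_one_left (norm_nonneg _) (radialCutoff_le_one n x)).trans
      (h1.trans (h2.trans h3))

/-- A bounded functional on `C₀` extends continuously to the characters. -/
theorem exists_continuous_limit_cutoffCharacter (L : C₀(E, ℂ) →L[ℂ] ℂ) :
    ∃ G : E → ℂ, Continuous G ∧ ∀ w, Tendsto (fun n => L (cutoffCharacter n w)) atTop (𝓝 (G w)) := by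
  -- Differences of cutoff characters have norm at most 1 and vanish on a large ball whatever `w`
  -- is; the uniformity in `w` makes the limit continuous.
  have hcau : UniformCauchySeqOn (fun n w => L (cutoffCharacter n w)) atTop Set.univ := by
    rw [Metric.uniformCauchySeqOn_iff]
    intro ε hε
    obtain ⟨R, hR⟩ := exists_norm_functional_le_of_eq_zero L (half_pos hε)
    obtain ⟨N, hN⟩ := exists_nat_gt R
    refine ⟨N, fun m hm n hn w _ => ?_⟩
    rw [dist_eq_norm, ← map_sub]
    refine (hR _ ?_ fun x hx => ?_).trans_lt (half_lt_self hε)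
    · refine norm_le_of_forall _ zero_le_one fun x => ?_
      have e : (cutoffCharacter m w - cutoffCharacter n w) x =
          ((radialCutoff m x - radialCutoff n x : ℝ) : ℂ) *
            Complex.exp ((inner ℝ x w : ℝ) * Complex.I) := by
        change cutoffCharacter m w x - cutoffCharacter n w x = _
        rw [cutoffCharacter_apply, cutoffCharacter_apply]
        push_cast
        ring
      rw [e, norm_mul, Complex.norm_exp_ofReal_mul_I, mul_one, Complex.norm_real,
        Real.norm_eq_abs, abs_le]
      constructor <;> linarith [radialCutoff_nonneg n x, radialCutoff_le_one n x,
        radialCutoff_nonneg m x, radialCutoff_le_one m x]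
    · change cutoffCharacter m w x - cutoffCharacter n w x = 0
      have hm' : (N : ℝ) ≤ m := Nat.cast_le.2 hm
      have hn' : (N : ℝ) ≤ n := Nat.cast_le.2 hn
      rw [cutoffCharacter_apply, cutoffCharacter_apply, radialCutoff_eq_one (by linarith),
        radialCutoff_eq_one (by linarith), sub_self]
  choose G hG using fun w => cauchySeq_tendsto_of_complete (hcau.cauchySeq (Set.mem_univ w))
  have hu := hcau.tendstoUniformlyOn_of_tendsto fun w _ => hG w
  refine ⟨G, ?_, hG⟩
  rw [tendstoUniformlyOn_univ] at hu
  exact hu.continuous (Frequently.of_forall fun n =>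
    L.continuous.comp (continuous_cutoffCharacter n))

theorem exists_schwartzMap_norm_sub_le [FiniteDimensional ℝ E] (g : C₀(E, ℂ)) {ε : ℝ} (hε : 0 < ε) :
    ∃ s : SchwartzMap E ℂ, ‖g - s.toZeroAtInfty‖ ≤ ε := by
  have hu : UniformContinuous g := ZeroAtInftyContinuousMap.uniformContinuous g
  obtain ⟨h, hh, hgh⟩ := hu.exists_contDiff_dist_le (half_pos hε)
  obtain ⟨R, hR⟩ := exists_norm_lt_of_tendsto_cocompact (zero_at_infty g) (half_pos hε)
  let b : ContDiffBump (0 : E) := ⟨max R 1, max R 1 + 1, by positivity, by linarith⟩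
  have hsm : ContDiff ℝ (⊤ : ℕ∞) fun x => b x • h x := b.contDiff.smul hh
  have hcs : HasCompactSupport fun x => b x • h x := b.hasCompactSupport.smul_right
  refine ⟨hcs.toSchwartzMap hsm, norm_le_of_forall _ hε.le fun x => ?_⟩
  change ‖g x - b x • h x‖ ≤ ε
  have e : g x - b x • h x = b x • (g x - h x) + (1 - b x) • g x := by
    simp only [Complex.real_smul]; push_cast; ring
  rw [e]
  refine (norm_add_le _ _).trans ?_
  have h1 : ‖b x • (g x - h x)‖ ≤ ε / 2 := by
    rw [norm_smul, Real.norm_of_nonneg b.nonneg, ← dist_eq_norm]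
    exact (mul_le_of_le_one_left dist_nonneg b.le_one).trans (by
      rw [dist_comm]; exact (hgh x).le)
  have h2 : ‖(1 - b x) • g x‖ ≤ ε / 2 := by
    rw [norm_smul, Real.norm_of_nonneg (by linarith [b.le_one (x := x)])]
    rcases le_or_gt ‖x‖ (max R 1) with hx | hx
    · rw [b.one_of_mem_closedBall (by rwa [mem_closedBall_zero_iff])]
      simp [(half_pos hε).le]
    · exact (mul_le_of_le_one_left (norm_nonneg _) (by linarith [b.nonneg (x := x)])).trans
        (hR x ((le_max_left _ _).trans_lt hx)).le
  linarith

variable [MeasurableSpace E] [BorelSpace E]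

/-- Exchanges `L` with a superposition of characters: valid after cutting off, where the integral
lives in `C₀`, and then in the limit by dominated convergence. It serves both for `Λ` with `θ = id`
and for Fourier inversion with `θ` the dilation by 2π. -/
theorem functional_eq_integral_of_limit (L : C₀(E, ℂ) →L[ℂ] ℂ) {G : E → ℂ}
    (hG : ∀ w, Tendsto (fun n => L (cutoffCharacter n w)) atTop (𝓝 (G w)))
    {μ : Measure E} {φ : E → ℂ} (hφ : Integrable φ μ) {θ : E → E} (hθ : Continuous θ)
    {f : C₀(E, ℂ)}
    (hf : ∀ x, f x = ∫ w, φ w * Complex.exp ((inner ℝ x (θ w) : ℝ) * Complex.I) ∂μ) :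
    L f = ∫ w, φ w * G (θ w) ∂μ := by
  have hcc : ∀ n, Continuous fun w => cutoffCharacter n (θ w) := fun n =>
    (continuous_cutoffCharacter n).comp hθ
  have hi : ∀ n, Integrable (fun w => φ w • cutoffCharacter n (θ w)) μ := fun n =>
    hφ.smul_bdd 1 (hcc n).aestronglyMeasurable
      (ae_of_all _ fun w => norm_cutoffCharacter_le n (θ w))
  have hcut : ∀ n, cutoffMul n f = ∫ w, φ w • cutoffCharacter n (θ w) ∂μ := fun n => by
    ext x
    let ev : C₀(E, ℂ) →L[ℂ] ℂ := LinearMap.mkContinuous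
      { toFun := fun g => g x, map_add' := fun _ _ => rfl, map_smul' := fun _ _ => rfl } 1
      fun g => by simpa using norm_apply_le_norm g x
    have h1 := ev.integral_comp_comm (hi n)
    refine Eq.trans ?_ h1
    change (radialCutoff n x : ℂ) * f x = ∫ w, φ w * (_ * _) ∂μ
    rw [hf, ← integral_const_mul]
    refine integral_congr_ae (ae_of_all _ fun w => ?_)
    simp only
    ring
  have hL : ∀ n, L (cutoffMul n f) = ∫ w, φ w * L (cutoffCharacter n (θ w)) ∂μ := fun n => by
    rw [hcut, ← L.integral_comp_comm (hi n)]
    simp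
  have h1 : Tendsto (fun n => L (cutoffMul n f)) atTop (𝓝 (L f)) :=
    (L.continuous.tendsto f).comp (tendsto_cutoffMul f)
  simp_rw [hL] at h1
  refine tendsto_nhds_unique h1 (tendsto_integral_of_dominated_convergence
    (fun w => ‖φ w‖ * ‖L‖) (fun n => ?_) (hφ.norm.mul_const _) (fun n => ae_of_all _ fun w => ?_)
    (ae_of_all _ fun w => (hG (θ w)).const_mul _))
  · exact hφ.1.mul (L.continuous.comp (hcc n)).aestronglyMeasurable
  · rw [norm_mul]
    refine mul_le_mul_of_nonneg_left ?_ (norm_nonneg _)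
    exact (L.le_of_opNorm_le_of_le le_rfl (norm_cutoffCharacter_le n (θ w))).trans_eq (mul_one _)

variable [FiniteDimensional ℝ E]

open scoped FourierTransform in
-- Fourier inversion writes a Schwartz function as a superposition of characters, so `L` kills it;
-- Schwartz functions are dense in `C₀`.
theorem functional_eq_zero_of_limit_eq_zero (L : C₀(E, ℂ) →L[ℂ] ℂ)
    (hG : ∀ w, Tendsto (fun n => L (cutoffCharacter n w)) atTop (𝓝 0)) : L = 0 := by
  have hs : ∀ s : SchwartzMap E ℂ, L s.toZeroAtInfty = 0 := fun s => by
    set F : SchwartzMap E ℂ := 𝓕 s with hF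
    have hinv : s = 𝓕⁻ F := (FourierTransform.fourierInv_fourier_eq s).symm
    have h := functional_eq_integral_of_limit L (G := fun _ => 0) hG F.integrable
      (μ := volume) (θ := fun w => (2 * Real.pi) • w) (by fun_prop) (f := s.toZeroAtInfty)
      fun x => by
        rw [SchwartzMap.toZeroAtInfty_apply, hinv, congrFun (SchwartzMap.fourierInv_coe F) x,
          Real.fourierInv_eq']
        refine integral_congr_ae (ae_of_all _ fun w => ?_)
        simp only [smul_eq_mul, real_inner_smul_right, real_inner_comm w x]
        ring
    simpa using h
  ext g
  by_contra hne
  have hpos : 0 < ‖L g‖ := norm_pos_iff.2 hne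
  obtain ⟨s, hgs⟩ := exists_schwartzMap_norm_sub_le g
    (show 0 < ‖L g‖ / (2 * (‖L‖ + 1)) by positivity)
  have h1 : ‖L g‖ ≤ ‖L‖ * (‖L g‖ / (2 * (‖L‖ + 1))) := by
    have := L.le_of_opNorm_le_of_le le_rfl hgs
    rwa [map_sub, hs, sub_zero] at this
  have h2 : ‖L‖ * (‖L g‖ / (2 * (‖L‖ + 1))) ≤ ‖L g‖ / 2 := by
    rw [mul_div_assoc', div_le_div_iff₀ (by positivity) (by positivity)]
    nlinarith
  linarith

theorem isC0Universal_of_support_eq_univ {ψ : E → ℝ} (hc : Continuous ψ)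
    (hψ : IsPDKernel fun x y : E => ψ (x - y)) (h0 : Tendsto ψ (cocompact E) (𝓝 0))
    {Λ : Measure E} [IsFiniteMeasure Λ]
    (hΛ : ∀ t, charFun Λ t = ψ t) (hsupp : Λ.support = Set.univ) :
    IsC0Universal fun x y : E => ψ (x - y) := by
  have htend : ∀ y, Tendsto (fun x => ψ (x - y)) (cocompact E) (𝓝 0) := fun y =>
    h0.comp (Homeomorph.subRight y).isClosedEmbedding.tendsto_cocompact
  refine ⟨hψ, ⟨ψ 0, fun x y => hψ.abs_le_apply_zero _⟩, fun y => ⟨by fun_prop, htend y⟩,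
    fun g ε hε => ?_⟩
  let v : E → C₀(E, ℂ) := fun y => ⟨⟨fun x => (ψ (x - y) : ℂ), by fun_prop⟩, by
    exact (Complex.continuous_ofReal.tendsto' 0 0 rfl).comp (htend y)⟩
  let g' : C₀(E, ℂ) := ⟨⟨fun x => (g x : ℂ), by fun_prop⟩, by
    exact (Complex.continuous_ofReal.tendsto' 0 0 rfl).comp (zero_at_infty g)⟩
  have hdense := mem_closure_span_of_forall_dual (S := Set.range v) (fun L hL => by
    obtain ⟨G, hGc, hG⟩ := exists_continuous_limit_cutoffCharacter L
    have hGb : ∀ w, ‖G w‖ ≤ ‖L‖ := fun w => le_of_tendsto' (hG w).norm fun n =>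
      (L.le_of_opNorm_le_of_le le_rfl (norm_cutoffCharacter_le n w)).trans_eq (mul_one _)
    have hG0 : ∀ w, G w = 0 := fun w => by
      refine eq_zero_of_mem_support_of_ae_eq_zero hGc
        (ae_eq_zero_of_integral_mul_character_eq_zero hGc.measurable
          (Integrable.of_bound hGc.aestronglyMeasurable ‖L‖ (ae_of_all _ hGb)) fun t => ?_)
        (hsupp ▸ Set.mem_univ w)
      have hi : Integrable (fun w => Complex.exp ((inner ℝ w t : ℝ) * Complex.I)) Λ :=
        Integrable.of_bound (Continuous.aestronglyMeasurable (by fun_prop)) 1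
          (ae_of_all _ fun w => (Complex.norm_exp_ofReal_mul_I _).le)
      have h := functional_eq_integral_of_limit L hG hi continuous_id (f := v (-t)) fun x => by
        change ((ψ (x - -t) : ℝ) : ℂ) = _
        rw [← hΛ, charFun_apply]
        refine integral_congr_ae (ae_of_all _ fun w => ?_)
        simp only [id]
        rw [← Complex.exp_add, sub_neg_eq_add, inner_add_right, real_inner_comm x w]
        push_cast
        ring_nf
      rw [hL _ ⟨-t, rfl⟩] at h
      refine Eq.trans ?_ h.symm
      refine integral_congr_ae (ae_of_all _ fun w => ?_)
      simp only [id, mul_comm]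
    exact functional_eq_zero_of_limit_eq_zero L fun w => hG0 w ▸ hG w) g'
  obtain ⟨s, hs, hgs⟩ := Metric.mem_closure_iff.1 hdense ε hε
  obtain ⟨⟨f, hf, hfs⟩, -⟩ := exists_rkhs_re_im hψ
    ({ toFun := fun h x => h x, map_add' := fun _ _ => rfl, map_smul' := fun _ _ => rfl } :
      C₀(E, ℂ) →ₗ[ℂ] E → ℂ) id v (fun y z => rfl) hs
  refine ⟨f, hf, fun x => ?_⟩
  have hfx : f x = (s x).re := hfs x
  rw [hfx, abs_sub_comm]
  rw [dist_eq_norm] at hgs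
  have h2 := (Complex.abs_re_le_norm _).trans ((norm_apply_le_norm (g' - s) x).trans hgs.le)
  change |((g x : ℂ) - s x).re| ≤ ε at h2
  simpa using h2

end VanishingAtInfinity

/-! ### Necessity of full support; compactly supported ψ -/

section Necessity

open scoped FourierTransform

variable {E : Type*} [NormedAddCommGroup E] [InnerProductSpace ℝ E]
  [FiniteDimensional ℝ E]

theorem exists_schwartzMap_bump (v₀ : E) {r : ℝ} (hr : 0 < r) :
    ∃ φ : SchwartzMap E ℂ, φ v₀ = 1 ∧ ∀ x, r ≤ dist x v₀ → φ x = 0 := by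
  obtain ⟨b, hb⟩ : ∃ b : ContDiffBump v₀, b.rOut = r :=
    ⟨⟨r / 2, r, half_pos hr, half_lt_self hr⟩, rfl⟩
  have hcs : HasCompactSupport fun x => (b x : ℂ) :=
    b.hasCompactSupport.comp_left (g := Complex.ofReal) Complex.ofReal_zero
  have hsm : ContDiff ℝ (⊤ : ℕ∞) fun x => (b x : ℂ) := Complex.ofRealCLM.contDiff.comp b.contDiff
  refine ⟨hcs.toSchwartzMap hsm, ?_, fun x hx => ?_⟩
  · change ((b v₀ : ℝ) : ℂ) = 1
    rw [b.one_of_mem_closedBall (Metric.mem_closedBall_self b.rIn_pos.le), Complex.ofReal_one]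
  · change ((b x : ℝ) : ℂ) = 0
    rw [b.zero_of_le_dist (hb.trans_le hx), Complex.ofReal_zero]

variable [MeasurableSpace E] [BorelSpace E]

/-- By Fubini and Fourier inversion the integral equals `∫ exp(-i⟨w, y⟩) φ(w/2π) dΛ(w)`. -/
theorem integral_mul_translate_eq_zero {Λ : Measure E} [IsFiniteMeasure Λ] {ψ : E → ℝ}
    (hΛ : ∀ t, charFun Λ t = ψ t) {φ : SchwartzMap E ℂ}
    (hφ : ∀ᵐ w ∂Λ, φ ((2 * Real.pi)⁻¹ • w) = 0) (y : E) :
    ∫ x, (𝓕 φ : SchwartzMap E ℂ) x * (ψ (x - y) : ℂ) = 0 := by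
  set F : SchwartzMap E ℂ := 𝓕 φ with hF
  have hinv : ∀ w, φ w = 𝓕⁻ (F : E → ℂ) w := fun w => by
    rw [← congrFun (SchwartzMap.fourierInv_coe F) w, hF, FourierTransform.fourierInv_fourier_eq]
  have e1 : ∀ x, F x * (ψ (x - y) : ℂ) =
      ∫ w, F x * Complex.exp ((inner ℝ w (x - y) : ℝ) * Complex.I) ∂Λ := fun x => by
    rw [integral_const_mul, ← hΛ, charFun_apply]
  simp_rw [e1]
  rw [integral_integral_swap]
  · refine integral_eq_zero_of_ae ?_
    filter_upwards [hφ] with w hw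
    rw [hinv, Real.fourierInv_eq'] at hw
    have e2 : ∀ x, F x * Complex.exp ((inner ℝ w (x - y) : ℝ) * Complex.I) =
        Complex.exp (-(inner ℝ w y : ℝ) * Complex.I) *
        (Complex.exp ((2 * Real.pi * inner ℝ x ((2 * Real.pi)⁻¹ • w) : ℝ) * Complex.I) • F x) := by
      intro x
      rw [smul_eq_mul, ← mul_assoc, ← Complex.exp_add, mul_comm (F x), real_inner_smul_right,
        mul_inv_cancel_left₀ (by positivity), inner_sub_right, real_inner_comm w x]
      push_cast
      ring_nf
    simp_rw [e2]
    rw [integral_const_mul, hw, mul_zero, Pi.zero_apply]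
  · have h1 : Integrable (fun p : E × E => F p.1) (volume.prod Λ) := F.integrable.comp_fst Λ
    exact h1.mul_bdd (c := 1) (by fun_prop)
      (ae_of_all _ fun p => (Complex.norm_exp_ofReal_mul_I _).le)

/-- Combinations of sections approximate `g` uniformly, and a uniform error `ε` costs at most `ε ∫
‖F‖`. -/
theorem integral_mul_eq_zero_of_isC0Universal {ψ : E → ℝ} (hc : Continuous ψ)
    (hu : IsC0Universal fun x y : E => ψ (x - y)) {F : E → ℂ} (hF : Integrable F)
    (hy : ∀ y, ∫ x, F x * (ψ (x - y) : ℂ) = 0) (g : C₀(E, ℝ)) :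
    ∫ x, F x * (g x : ℂ) = 0 := by
  obtain ⟨hk, -, -, happ⟩ := hu
  have hspan : ∀ f ∈ Submodule.span ℝ (Set.range fun y x : E => ψ (x - y)),
      Integrable (fun x => F x * (f x : ℂ)) ∧ ∫ x, F x * (f x : ℂ) = 0 := by
    intro f hf
    induction hf using Submodule.span_induction with
    | mem _ h =>
      obtain ⟨y, rfl⟩ := h
      refine ⟨hF.mul_bdd (c := ψ 0) (by fun_prop) (ae_of_all _ fun x => ?_), hy y⟩
      rw [Complex.norm_real]
      exact hk.abs_le_apply_zero _
    | zero => simp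
    | add f₁ f₂ _ _ h₁ h₂ =>
      have e : (fun x => F x * (((f₁ + f₂) x : ℝ) : ℂ)) =
          fun x => F x * (f₁ x : ℂ) + F x * (f₂ x : ℂ) := by
        funext x; simp [mul_add]
      rw [e]
      exact ⟨h₁.1.add h₂.1, by rw [integral_add h₁.1 h₂.1, h₁.2, h₂.2, add_zero]⟩
    | smul c f _ h =>
      have e : (fun x => F x * (((c • f) x : ℝ) : ℂ)) = fun x => c * (F x * (f x : ℂ)) := by
        funext x; simp; ring
      rw [e]
      exact ⟨h.1.const_mul _, by rw [integral_const_mul, h.2, mul_zero]⟩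
  have hgi : Integrable fun x => F x * (g x : ℂ) := by
    refine hF.mul_bdd (c := ‖g.toBCF‖) (by fun_prop) (ae_of_all _ fun x => ?_)
    rw [Complex.norm_real]
    exact g.toBCF.norm_coe_le_norm x
  have hbound : ∀ ε > 0, ‖∫ x, F x * (g x : ℂ)‖ ≤ ε * ∫ x, ‖F x‖ := by
    intro ε hε
    obtain ⟨f, hf, hfg⟩ := happ g (ε / 2) (half_pos hε)
    obtain ⟨f', hf', hff'⟩ := exists_span_sections_approx hk (fun x y => hk.abs_le_apply_zero _)
      hf (half_pos hε)
    obtain ⟨hi, h0⟩ := hspan f' hf'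
    rw [← sub_zero (∫ x, F x * (g x : ℂ)), ← h0, ← integral_sub hgi hi, ← integral_const_mul]
    refine norm_integral_le_of_norm_le (hF.norm.const_mul ε) (ae_of_all _ fun x => ?_)
    rw [← mul_sub, ← Complex.ofReal_sub, norm_mul, Complex.norm_real, mul_comm]
    refine mul_le_mul_of_nonneg_right ?_ (norm_nonneg _)
    have e : g x - f' x = -(f x - g x) + (f x - f' x) := by ring
    rw [e]
    refine (norm_add_le _ _).trans ?_
    rw [norm_neg]
    have h1 := hfg x
    have h2 := hff' x
    simp only [Real.norm_eq_abs]
    linarith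
  by_contra hne
  have hpos : 0 < ‖∫ x, F x * (g x : ℂ)‖ := norm_pos_iff.2 hne
  set I := ∫ x, ‖F x‖ with hI
  have hI0 : 0 ≤ I := integral_nonneg fun x => norm_nonneg _
  have h1 := hbound (‖∫ x, F x * (g x : ℂ)‖ / (2 * (I + 1))) (by positivity)
  have h2 : ‖∫ x, F x * (g x : ℂ)‖ / (2 * (I + 1)) * I ≤ ‖∫ x, F x * (g x : ℂ)‖ / 2 := by
    rw [div_mul_eq_mul_div, div_le_div_iff₀ (by positivity) (by positivity)]
    nlinarith
  linarith

theorem support_eq_univ_of_isC0Universal {ψ : E → ℝ} (hc : Continuous ψ) {Λ : Measure E}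
    [IsFiniteMeasure Λ] (hΛ : ∀ t, charFun Λ t = ψ t)
    (hu : IsC0Universal fun x y : E => ψ (x - y)) : Λ.support = Set.univ := by
  by_contra hne
  obtain ⟨w₀, hw₀⟩ := (Set.ne_univ_iff_exists_notMem _).1 hne
  have hVo : IsOpen ((fun w : E => (2 * Real.pi) • w) ⁻¹' Λ.supportᶜ) :=
    Measure.isClosed_support.isOpen_compl.preimage (continuous_const_smul _)
  set v₀ : E := (2 * Real.pi)⁻¹ • w₀ with hv₀
  have hv : v₀ ∈ (fun w : E => (2 * Real.pi) • w) ⁻¹' Λ.supportᶜ := by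
    rw [Set.mem_preimage, hv₀, smul_inv_smul₀ (by positivity)]
    exact hw₀
  obtain ⟨r, hr, hball⟩ := Metric.isOpen_iff.1 hVo v₀ hv
  obtain ⟨φ, h2, hφ0⟩ := exists_schwartzMap_bump v₀ hr
  have hφ : ∀ᵐ w ∂Λ, φ ((2 * Real.pi)⁻¹ • w) = 0 := by
    filter_upwards [Measure.support_mem_ae (μ := Λ)] with w hw
    refine hφ0 _ ?_
    by_contra hlt
    have hmem := hball (Metric.mem_ball.2 (not_le.1 hlt))
    rw [Set.mem_preimage, smul_inv_smul₀ (by positivity)] at hmem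
    exact hmem hw
  set F : SchwartzMap E ℂ := 𝓕 φ with hF
  have hzero : ∀ᵐ x, F x = 0 := by
    refine ae_eq_zero_of_integral_contDiff_smul_eq_zero F.integrable.locallyIntegrable
      fun g hg hgc => ?_
    have h := integral_mul_eq_zero_of_isC0Universal hc hu F.integrable
      (integral_mul_translate_eq_zero hΛ hφ) ⟨⟨g, hg.continuous⟩, by
        refine tendsto_const_nhds.congr' ?_
        filter_upwards [hgc.isCompact.compl_mem_cocompact] with x hx
        exact (image_eq_zero_of_notMem_tsupport hx).symm⟩
    refine Eq.trans (integral_congr_ae (ae_of_all _ fun x => ?_)) h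
    simp only [Complex.real_smul]
    exact mul_comm _ _
  have h1 : φ v₀ = 0 := by
    have hinv : φ v₀ = 𝓕⁻ (F : E → ℂ) v₀ := by
      rw [← congrFun (SchwartzMap.fourierInv_coe F) v₀, hF, FourierTransform.fourierInv_fourier_eq]
    rw [hinv, Real.fourierInv_eq']
    refine integral_eq_zero_of_ae ?_
    filter_upwards [hzero] with x hx
    simp [hx]
  exact zero_ne_one (h1.symm.trans h2)

/-- Integration against a continuous function over a compact set. -/
noncomputable def integralMulCLM (Z : Set E) [CompactSpace Z] (f : C(Z, ℂ)) :
    C(Z, ℂ) →L[ℂ] ℂ :=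
  haveI : IsFiniteMeasure (volume.comap ((↑) : Z → E)) := by
    have hZ : IsCompact Z := isCompact_iff_compactSpace.2 inferInstance
    refine ⟨?_⟩
    rw [comap_subtype_coe_apply hZ.measurableSet]
    exact (measure_mono (by simp)).trans_lt hZ.measure_lt_top
  LinearMap.mkContinuous
    { toFun := fun g => ∫ z, g z * f z ∂(volume.comap ((↑) : Z → E))
      map_add' := fun g h => by
        rw [← integral_add]
        · simp [add_mul]
        · exact Integrable.of_bound (by fun_prop) ‖g * f‖
            (ae_of_all _ fun z => (g * f).norm_coe_le_norm z)
        · exact Integrable.of_bound (by fun_prop) ‖h * f‖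
            (ae_of_all _ fun z => (h * f).norm_coe_le_norm z)
      map_smul' := fun c g => by
        rw [RingHom.id_apply, smul_eq_mul, ← integral_const_mul]
        simp [mul_assoc] }
    (‖f‖ * (volume.comap ((↑) : Z → E)).real Set.univ) fun g => by
      refine (norm_integral_le_of_norm_le_const (C := ‖f‖ * ‖g‖)
        (ae_of_all _ fun z => ?_)).trans_eq (by ring)
      rw [norm_mul, mul_comm]
      gcongr
      · exact f.norm_coe_le_norm z
      · exact g.norm_coe_le_norm z

/-- The transform is the value on characters of a functional on `C(tsupport ψ, ℂ)`, so the analytic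
continuation argument used for `cc`-universality applies again. -/
theorem cosTransform_eq_zero_of_isOpen {ψ : E → ℝ} (hc : Continuous ψ) (hs : HasCompactSupport ψ)
    (he : ∀ x, ψ (-x) = ψ x) {U : Set E} (hU : IsOpen U) (hne : U.Nonempty)
    (h : ∀ w ∈ U, cosTransform ψ w = 0) (w : E) : cosTransform ψ w = 0 := by
  have hcomp : CompactSpace (tsupport ψ) := isCompact_iff_compactSpace.1 hs.isCompact
  have hi : Integrable ψ := hc.integrable_of_hasCompactSupport hs
  have key : ∀ w, integralMulCLM (tsupport ψ) ⟨fun z => (ψ z : ℂ), by fun_prop⟩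
      (restrictedCharacter (tsupport ψ) w) = cosTransform ψ w := fun w => by
    change ∫ z : tsupport ψ, Complex.exp ((inner ℝ (z : E) w : ℝ) * Complex.I) * (ψ z : ℂ)
      ∂(volume.comap ((↑) : tsupport ψ → E)) = _
    rw [integral_subtype_comap (isClosed_tsupport ψ).measurableSet
      (fun x : E => Complex.exp ((inner ℝ x w : ℝ) * Complex.I) * (ψ x : ℂ)),
      setIntegral_eq_integral_of_forall_compl_eq_zero fun x hx => by
        simp [image_eq_zero_of_notMem_tsupport hx]]
    have h1 := fourier_ofReal_of_even hi he ((2 * Real.pi)⁻¹ • w)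
    rw [smul_inv_smul₀ (by positivity)] at h1
    have hinv : 𝓕⁻ (fun u => (ψ u : ℂ)) = 𝓕 fun u => (ψ u : ℂ) := by
      rw [Real.fourierInv_eq_fourier_comp_neg]
      simp only [he]
    rw [← h1, ← hinv, Real.fourierInv_eq']
    refine integral_congr_ae (ae_of_all _ fun x => ?_)
    simp only [real_inner_smul_right, smul_eq_mul]
    rw [mul_inv_cancel_left₀ (by positivity)]
  have h2 := functional_restrictedCharacter_eq_zero (integralMulCLM (tsupport ψ)
    ⟨fun z => (ψ z : ℂ), by fun_prop⟩) hU hne (fun w hw => by rw [key, h w hw, Complex.ofReal_zero]) w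
  rw [key] at h2
  exact_mod_cast h2

/-- By uniqueness `Λ` is `cosTransformMeasure ψ`, whose density is continuous and so vanishes on the
open complement of the support. Were that nonempty, the density would vanish everywhere,
contradicting total mass `ψ 0 > 0`. -/
theorem support_eq_univ_of_hasCompactSupport {ψ : E → ℝ} (hc : Continuous ψ)
    (hs : HasCompactSupport ψ) (hψ : IsPDKernel fun x y : E => ψ (x - y)) (h0 : 0 < ψ 0)
    {Λ : Measure E} [IsFiniteMeasure Λ] (hΛ : ∀ t, charFun Λ t = ψ t) :
    Λ.support = Set.univ := by
  have hi : Integrable ψ := hc.integrable_of_hasCompactSupport hs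
  have hpos : ∀ w, 0 ≤ cosTransform ψ w := hψ.integral_mul_cos_nonneg hc hi
  obtain ⟨hfin, hchar⟩ := isFiniteMeasure_and_charFun_cosTransformMeasure hc hi hψ.even hpos
  obtain rfl : Λ = cosTransformMeasure ψ := Measure.ext_of_charFun (funext fun t => by
    rw [hΛ, hchar])
  by_contra hne
  have hU : IsOpen (cosTransformMeasure ψ).supportᶜ := Measure.isClosed_support.isOpen_compl
  have hUne : (cosTransformMeasure ψ).supportᶜ.Nonempty := Set.nonempty_compl.2 hne
  have hm : Measurable fun w : E => (2 * Real.pi) • w := by fun_prop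
  have hcos := continuous_cosTransform hi
  have hVo := hU.preimage (continuous_const_smul (2 * Real.pi))
  have hnull : (cosTransformMeasure ψ) (cosTransformMeasure ψ).supportᶜ = 0 :=
    Measure.measure_compl_support
  have hz : ∀ w ∈ (cosTransformMeasure ψ).supportᶜ, cosTransform ψ w = 0 := by
    -- Makes the set opaque, since its definition involves the measure about to be unfolded.
    generalize (cosTransformMeasure ψ).supportᶜ = U at *
    rw [cosTransformMeasure, Measure.map_apply hm hU.measurableSet,
      withDensity_apply _ hVo.measurableSet, lintegral_eq_zero_iff (by fun_prop)] at hnull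
    have hae : (fun w : E => cosTransform ψ ((2 * Real.pi) • w))
        =ᵐ[volume.restrict ((fun w : E => (2 * Real.pi) • w) ⁻¹' U)] fun _ => 0 := by
      filter_upwards [hnull] with w hw
      exact le_antisymm (ENNReal.ofReal_eq_zero.1 hw) (hpos _)
    have heq := Measure.eqOn_open_of_ae_eq hae hVo (by fun_prop) continuousOn_const
    intro w hw
    have := heq (x := (2 * Real.pi)⁻¹ • w) (by
      rw [Set.mem_preimage, smul_inv_smul₀ (by positivity)]; exact hw)
    simpa only [smul_inv_smul₀ (show 2 * Real.pi ≠ 0 by positivity)] using this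
  have hall := cosTransform_eq_zero_of_isOpen hc hs hψ.even hU hUne hz
  have h1 := hchar 0
  rw [cosTransformMeasure] at h1
  simp [hall] at h1
  exact h0.ne (by exact_mod_cast h1)

end Necessity

/-! ### The sign convention and the main theorem -/

section BochnerMeasure

variable {d : ℕ} {ψ : EuclideanSpace ℝ (Fin d) → ℝ}

theorem isBochnerMeasure_iff (he : ∀ x, ψ (-x) = ψ x) (Λ : Measure (EuclideanSpace ℝ (Fin d))) :
    IsBochnerMeasure ψ Λ ↔ IsFiniteMeasure Λ ∧ ∀ t, charFun Λ t = ψ t := by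
  have e : ∀ x, ∫ ω, Complex.exp (-(Complex.I * ((inner ℝ x ω : ℝ) : ℂ))) ∂Λ =
      charFun Λ (-x) := fun x => by
    rw [charFun_apply]
    refine integral_congr_ae (ae_of_all _ fun w => ?_)
    simp only [inner_neg_right, real_inner_comm x w]
    push_cast
    ring_nf
  refine and_congr_right fun _ => ⟨fun h t => ?_, fun h x => ?_⟩
  · rw [← he, h, e, neg_neg]
  · rw [e, h, he]

end BochnerMeasure

theorem mainTheorem5 (d : ℕ) (ψ : EuclideanSpace ℝ (Fin d) →ᵇ ℝ) (hψ_ne : ψ ≠ 0)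
    (hψ_pd : IsPDKernel fun x y : EuclideanSpace ℝ (Fin d) => ψ (x - y)) :
    ∃ Λ : Measure (EuclideanSpace ℝ (Fin d)),
      (IsBochnerMeasure ψ Λ ∧
        ∀ Λ' : Measure (EuclideanSpace ℝ (Fin d)), IsBochnerMeasure ψ Λ' → Λ' = Λ) ∧
      (Tendsto ψ (cocompact (EuclideanSpace ℝ (Fin d))) (𝓝 0) →
        (IsC0Universal (fun x y : EuclideanSpace ℝ (Fin d) => ψ (x - y)) ↔
          Λ.support = Set.univ)) ∧
      (HasCompactSupport ψ →
        IsC0Universal (fun x y : EuclideanSpace ℝ (Fin d) => ψ (x - y))) ∧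
      ((interior Λ.support).Nonempty →
        IsCCUniversal (fun x y : EuclideanSpace ℝ (Fin d) => ψ (x - y))) := by
  have hc : Continuous ψ := ψ.continuous
  -- Since `|ψ x| ≤ ψ 0`, the value at the origin vanishes only for `ψ = 0`.
  have h0 : 0 < ψ 0 := by
    refine hψ_pd.apply_zero_nonneg.lt_of_ne fun h => hψ_ne ?_
    ext x
    have := hψ_pd.abs_le_apply_zero x
    rw [← h] at this
    exact abs_nonpos_iff.1 this
  obtain ⟨Λ, hfin, hΛ⟩ := hψ_pd.exists_charFun_eq hc h0
  refine ⟨Λ, ⟨(isBochnerMeasure_iff hψ_pd.even Λ).2 ⟨hfin, hΛ⟩, fun Λ' hΛ' => ?_⟩, fun htend =>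
    ⟨support_eq_univ_of_isC0Universal hc hΛ, isC0Universal_of_support_eq_univ hc hψ_pd htend hΛ⟩,
    fun hs => ?_, isCCUniversal_of_nonempty_interior_support hc hψ_pd hΛ⟩
  · obtain ⟨hfin', hchar⟩ := (isBochnerMeasure_iff hψ_pd.even Λ').1 hΛ'
    exact Measure.ext_of_charFun (funext fun t => by rw [hchar, hΛ])
  · refine isC0Universal_of_support_eq_univ hc hψ_pd ?_ hΛ
      (support_eq_univ_of_hasCompactSupport hc hs hψ_pd h0 hΛ)
    refine tendsto_const_nhds.congr' ?_
    filter_upwards [hs.isCompact.compl_mem_cocompact] with x hx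
    exact (image_eq_zero_of_notMem_tsupport hx).symm
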